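/- Let $G$ be a Polish group. A $G$-flow is a compact Hausdorff space with a continuous action of $G$. An affine $G$-flow is a compact convex subset $K$ of a Hausdorff locally convex real topological vector space together with a continuous action of $G$ on $K$ by affine homeomorphisms; an affine subflow of $K$ is a nonempty compact convex $G$-invariant subset, and $\overline{\mathrm{ext}}(K)$ is the closure of the set of extreme points of $K$. For a $G$-flow $X$, $P(X)$ is the affine $G$-flow of regular Borel probability measures on $X$, with the weak-$*$ topology and the push-forward action. An affine extension $\phi\colon K\to L$ of affine $G$-flows is a continuous, affine, $G$-equivariant surjection. It is proximally irreducible if every affine subflow $C\subseteq K$ with $$C\cap \mathrm{conv}\bigl(\overline{\mathrm{ext}}(K)\cap\phi^{-1}(\{y\})\bigr)\neq\emptyset\quad\text{for all }y\in\overline{\mathrm{ext}}(L)$$ is equal to $K$ (here $\mathrm{conv}$ is the convex hull, not closed). An affine $G$-flow $K$ is proximally irreducible if every proximally irreducible extension $P\to K$ is an isomorphism. A maximal proximally irreducible extension of $L$ is a proximally irreducible extension $\phi\colon K\to L$ for which the affine $G$-flow $K$ is proximally irreducible. 1. (Existence.) Let $L$ be an affine $G$-flow such that, whenever $\phi\colon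 K\to L$ and $\psi\colon P\to K$ are proximally irreducible extensions of affine $G$-flows, $\phi\circ\psi\colon P\to L$ is also proximally irreducible. Then there are a $G$-flow $X$ and a maximal proximally irreducible extension $\phi\colon P(X)\to L$. 2. (Uniqueness.) Let $L$ be an affine $G$-flow. If $\phi\colon K\to L$ and $\psi\colon K'\to L$ are maximal proximally irreducible extensions, then there is an isomorphism of affine $G$-flows $\eta\colon K\to K'$ with $\psi\circ\eta=\phi$. If moreover $K=P(X)$ and $K'=P(Z)$ for $G$-flows $X$ and $Z$, then $X$ and $Z$ are isomorphic $G$-flows. 3. (Examples.) If $Y$ is a $G$-flow that is minimal (every orbit is dense) or has a comeager orbit, then $L=P(Y)$ satisfies the hypothesis of part 1. -/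

import Mathlib

open Set Topology MeasureTheory

universe u

/-- A `G`-flow: a compact Hausdorff space with a (jointly) continuous left action of `G`. -/
structure GFlow (G : Type u) [Group G] [TopologicalSpace G] where
  carrier : Type u
  [top : TopologicalSpace carrier]
  [compact : CompactSpace carrier]
  [t2 : T2Space carrier]
  [action : MulAction G carrier]
  [cont : ContinuousSMul G carrier]

namespace GFlow

variable {G : Type u} [Group G] [TopologicalSpace G]

instance : CoeSort (GFlow G) (Type u) := ⟨GFlow.carrier⟩

attribute [instance] GFlow.top GFlow.compact GFlow.t2 GFlow.action GFlow.cont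

end GFlow

/-- A map between subsets of real vector spaces (thought of as convex sets) is affine when it
preserves the convex combinations that lie in the domain. -/
def PreservesConvexComb {E F : Type u} [AddCommGroup E] [Module ℝ E] [AddCommGroup F] [Module ℝ F]
    {s : Set E} {t : Set F} (f : s → t) : Prop :=
  ∀ (x y z : s) (a b : ℝ), 0 ≤ a → 0 ≤ b → a + b = 1 →
    (z : E) = a • (x : E) + b • (y : E) → (f z : F) = a • (f x : F) + b • (f y : F)

/-- An affine `G`-flow: a compact convex subset of a Hausdorff locally convex real topological
vector space with a (jointly) continuous left action of `G` by affine maps. The action is an action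
on the compact convex set only, not on the ambient space. -/
structure AffineFlow (G : Type u) [Group G] [TopologicalSpace G] where
  E : Type u
  [addCommGroup : AddCommGroup E]
  [module : Module ℝ E]
  [top : TopologicalSpace E]
  [addGroup : IsTopologicalAddGroup E]
  [contSMul : ContinuousSMul ℝ E]
  [locallyConvex : LocallyConvexSpace ℝ E]
  [t2 : T2Space E]
  carrier : Set E
  isCompact : IsCompact carrier
  convex : Convex ℝ carrier
  [action : MulAction G carrier]
  [cont : ContinuousSMul G carrier]
  affine : ∀ g : G, PreservesConvexComb (fun x : carrier => g • x)

namespace AffineFlow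

variable {G : Type u} [Group G] [TopologicalSpace G]

instance : CoeSort (AffineFlow G) (Type u) := ⟨fun K => K.carrier⟩

attribute [instance] AffineFlow.addCommGroup AffineFlow.module AffineFlow.top AffineFlow.addGroup
  AffineFlow.contSMul AffineFlow.locallyConvex AffineFlow.t2 AffineFlow.action AffineFlow.cont

/-- The closure of the set of extreme points of `K`. Since `K` is compact it is contained in `K`,
and it is the same whether the closure is taken in `K` or in the ambient space. -/
def extClosure (K : AffineFlow G) : Set K.E := closure (K.carrier.extremePoints ℝ)

/-- An affine subflow: a nonempty, compact, convex, `G`-invariant subset. -/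
structure IsAffineSubflow (K : AffineFlow G) (C : Set K.E) : Prop where
  subset : C ⊆ K.carrier
  nonempty : C.Nonempty
  isCompact : IsCompact C
  convex : Convex ℝ C
  smul_mem : ∀ (g : G) (x : K), (x : K.E) ∈ C → ((g • x : K) : K.E) ∈ C

/-- An affine extension: a surjective continuous `G`-equivariant affine map. -/
structure IsAffineExtension {K L : AffineFlow G} (φ : K → L) : Prop where
  continuous : Continuous φ
  map_smul : ∀ (g : G) (x : K), φ (g • x) = g • φ x
  affine : PreservesConvexComb φ
  surjective : Function.Surjective φ

/-- A proximally irreducible extension `φ : K → L`: an affine extension such that the only affine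
subflow `C` of `K` that meets the convex hull (without closure) of `extClosure K ∩ φ ⁻¹ {y}` for
every `y` in `extClosure L` is `K` itself. -/
structure IsProxIrrExtension {K L : AffineFlow G} (φ : K → L) : Prop
    extends IsAffineExtension φ where
  eq_of_meets : ∀ C : Set K.E, K.IsAffineSubflow C →
    (∀ y : L, (y : L.E) ∈ L.extClosure →
      (C ∩ convexHull ℝ (Subtype.val '' {x : K | (x : K.E) ∈ K.extClosure ∧ φ x = y})).Nonempty) →
    C = K.carrier

/-- An isomorphism of affine flows: a bijective affine extension (its inverse is then continuous,
equivariant and affine as well). -/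
structure IsAffineIso {K L : AffineFlow G} (φ : K → L) : Prop extends IsAffineExtension φ where
  injective : Function.Injective φ

/-- `K` is proximally irreducible: it has no nontrivial proximally irreducible extension, i.e.
each of its proximally irreducible extensions is an isomorphism. -/
def IsProxIrr (K : AffineFlow G) : Prop :=
  ∀ (P : AffineFlow G) (ψ : P → K), IsProxIrrExtension ψ → IsAffineIso ψ

/-- `φ : K → L` is a maximal proximally irreducible extension of `L`: it is a proximally
irreducible extension and `K` is proximally irreducible. -/
def IsMaxProxIrrExtension {K L : AffineFlow G} (φ : K → L) : Prop :=
  IsProxIrrExtension φ ∧ K.IsProxIrr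

/-- The composition of proximally irreducible extensions into `L` stays proximally irreducible. -/
def ComposesProxIrr (L : AffineFlow G) : Prop :=
  ∀ (K P : AffineFlow G) (φ : K → L) (ψ : P → K),
    IsProxIrrExtension φ → IsProxIrrExtension ψ → IsProxIrrExtension (φ ∘ ψ)

end AffineFlow

/-- `P(X)`: the regular Borel probability measures on `X`, viewed as a subset of `C(X)^*` with the
weak-* topology by identifying a measure `μ` with the functional `f ↦ ∫ f dμ`. -/
def regularProb (X : Type u) [TopologicalSpace X] [CompactSpace X] : Set (WeakDual ℝ C(X, ℝ)) :=
  letI : MeasurableSpace X := borel X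
  {Λ | ∃ μ : Measure X, μ.Regular ∧ IsProbabilityMeasure μ ∧ ∀ f : C(X, ℝ), Λ f = ∫ x, f x ∂μ}

section regularProb

variable {X : Type u} [TopologicalSpace X] [CompactSpace X] [T2Space X]

theorem mem_regularProb_iff (Λ : WeakDual ℝ C(X, ℝ)) :
    Λ ∈ regularProb X ↔ (∀ f : C(X, ℝ), 0 ≤ f → 0 ≤ Λ f) ∧ Λ 1 = 1 := by
  let : MeasurableSpace X := borel X
  have : BorelSpace X := ⟨rfl⟩
  constructor
  · rintro ⟨μ, hr, hp, h⟩
    refine ⟨fun f hf => ?_, ?_⟩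
    · rw [h]
      exact integral_nonneg fun x => hf x
    · rw [h]
      simp
  · rintro ⟨hpos, hone⟩
    let T : CompactlySupportedContinuousMap X ℝ →ₚ[ℝ] ℝ :=
      PositiveLinearMap.mk₀
        { toFun := fun f => Λ f.toContinuousMap
          map_add' := fun f g => by
            rw [← map_add]; rfl
          map_smul' := fun c f => by
            rw [RingHom.id_apply, ← map_smul]; rfl }
        (fun f hf => hpos _ fun x => hf x)
    have key : ∀ f : C(X, ℝ), Λ f = ∫ x, f x ∂(RealRMK.rieszMeasure T) := by
      intro f
      have h := RealRMK.integral_rieszMeasure T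
        (CompactlySupportedContinuousMap.continuousMapEquiv f)
      exact h.symm
    refine ⟨RealRMK.rieszMeasure T, inferInstance, ?_, key⟩
    have h1 := key 1
    rw [hone] at h1
    simp only [ContinuousMap.one_apply, integral_const, smul_eq_mul, mul_one] at h1
    have : IsFiniteMeasure (RealRMK.rieszMeasure T) :=
      ⟨isCompact_univ.measure_lt_top⟩
    refine ⟨?_⟩
    rw [measureReal_def] at h1
    rw [← ENNReal.ofReal_toReal (measure_ne_top (RealRMK.rieszMeasure T) univ), ← h1]
    simp

theorem abs_le_norm_of_mem_regularProb {Λ : WeakDual ℝ C(X, ℝ)} (h : Λ ∈ regularProb X)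
    (f : C(X, ℝ)) : |Λ f| ≤ ‖f‖ := by
  rw [mem_regularProb_iff] at h
  have h1 : 0 ≤ Λ (‖f‖ • (1 : C(X, ℝ)) - f) := h.1 _ fun x => by
    have := (abs_le.1 (f.norm_coe_le_norm x)).2
    simpa using this
  have h2 : 0 ≤ Λ (‖f‖ • (1 : C(X, ℝ)) + f) := h.1 _ fun x => by
    have := (abs_le.1 (f.norm_coe_le_norm x)).1
    simp
    linarith
  rw [map_sub, map_smul, h.2, smul_eq_mul] at h1
  rw [map_add, map_smul, h.2, smul_eq_mul] at h2
  rw [abs_le]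
  constructor <;> linarith

theorem isCompact_regularProb : IsCompact (regularProb X) := by
  have hc : IsClosed (regularProb X) := by
    have : regularProb X = (⋂ f : C(X, ℝ), ⋂ _ : 0 ≤ f, {Λ : WeakDual ℝ C(X, ℝ) | 0 ≤ Λ f}) ∩
        {Λ : WeakDual ℝ C(X, ℝ) | Λ 1 = 1} := by
      ext Λ
      rw [mem_regularProb_iff]
      simp
    rw [this]
    refine IsClosed.inter ?_ (isClosed_eq (WeakDual.eval_continuous _) continuous_const)
    exact isClosed_iInter fun f => isClosed_iInter fun _ =>
      isClosed_le continuous_const (WeakDual.eval_continuous f)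
  refine (WeakDual.isCompact_closedBall (𝕜 := ℝ) (E := C(X, ℝ)) 0 1).of_isClosed_subset hc ?_
  intro Λ hΛ
  simp only [mem_preimage, Metric.mem_closedBall, dist_zero_right]
  refine ContinuousLinearMap.opNorm_le_bound _ zero_le_one fun f => ?_
  rw [one_mul]
  exact abs_le_norm_of_mem_regularProb hΛ f

theorem convex_regularProb : Convex ℝ (regularProb X) := by
  intro Λ hΛ Θ hΘ a b ha hb hab
  rw [mem_regularProb_iff] at *
  have e : ∀ f, (a • Λ + b • Θ) f = a * Λ f + b * Θ f := fun f => rfl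
  refine ⟨fun f hf => ?_, ?_⟩
  · rw [e]
    exact add_nonneg (mul_nonneg ha (hΛ.1 f hf)) (mul_nonneg hb (hΘ.1 f hf))
  · rw [e, hΛ.2, hΘ.2]
    linarith

end regularProb

section action

variable {G : Type u} [Group G] [TopologicalSpace G] (X : GFlow G)

/-- The continuous map `x ↦ g • x`. -/
def smulMap (g : G) : C(X, X) := ⟨fun x => g • x, continuous_const_smul g⟩

/-- Push-forward of functionals along `x ↦ g • x`: `(g • Λ) f = Λ (f (g • ·))`. If `Λ` is
integration against `μ`, this is integration against the image of `μ` under `x ↦ g • x`. -/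
noncomputable def pushFunctional (g : G) (Λ : WeakDual ℝ C(X, ℝ)) : WeakDual ℝ C(X, ℝ) :=
  StrongDual.toWeakDual
    { toFun := fun f => Λ (f.comp (smulMap X g))
      map_add' := fun f h => by rw [ContinuousMap.add_comp, map_add]
      map_smul' := fun c f => by rw [ContinuousMap.smul_comp, map_smul, RingHom.id_apply]
      cont := (WeakDual.toStrongDual Λ).continuous.comp
        (ContinuousMap.continuous_precomp (smulMap X g)) }

theorem pushFunctional_apply (g : G) (Λ : WeakDual ℝ C(X, ℝ)) (f : C(X, ℝ)) :
    pushFunctional X g Λ f = Λ (f.comp (smulMap X g)) := rfl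

theorem pushFunctional_mem (g : G) {Λ : WeakDual ℝ C(X, ℝ)} (h : Λ ∈ regularProb X) :
    pushFunctional X g Λ ∈ regularProb X := by
  rw [mem_regularProb_iff] at *
  exact ⟨fun f hf => h.1 _ fun x => hf (g • x), h.2⟩

noncomputable instance regularProbAction : MulAction G (regularProb X) where
  smul g Λ := ⟨pushFunctional X g Λ.1, pushFunctional_mem X g Λ.2⟩
  one_smul Λ := by
    refine Subtype.ext (DFunLike.ext _ _ fun f => ?_)
    change Λ.1 (f.comp (smulMap X 1)) = Λ.1 f
    congr 1
    ext x
    exact congrArg f (one_smul G x)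
  mul_smul g h Λ := by
    refine Subtype.ext (DFunLike.ext _ _ fun f => ?_)
    change Λ.1 (f.comp (smulMap X (g * h))) = Λ.1 ((f.comp (smulMap X g)).comp (smulMap X h))
    congr 1
    ext x
    exact congrArg f (mul_smul g h x)

theorem regularProb_smul_apply (g : G) (Λ : regularProb X) (f : C(X, ℝ)) :
    (g • Λ).1 f = Λ.1 (f.comp (smulMap X g)) := rfl

instance regularProb_continuousSMul : ContinuousSMul G (regularProb X) where
  continuous_smul := by
    refine Continuous.subtype_mk (WeakDual.continuous_of_continuous_eval fun f => ?_) _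
    change Continuous fun p : G × regularProb X => p.2.1 (f.comp (smulMap X p.1))
    have hF : Continuous fun g : G => f.comp (smulMap X g) :=
      ContinuousMap.continuous_of_continuous_uncurry _
        (f.continuous.comp (continuous_smul (M := G) (X := X)))
    rw [continuous_iff_continuousAt]
    rintro ⟨g₀, Λ₀⟩
    have h1 : Filter.Tendsto (fun p : G × regularProb X => p.2.1 (f.comp (smulMap X g₀)))
        (𝓝 (g₀, Λ₀)) (𝓝 (Λ₀.1 (f.comp (smulMap X g₀)))) :=
      ((WeakDual.eval_continuous _).comp (continuous_subtype_val.comp continuous_snd)).tendsto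
        (g₀, Λ₀)
    have h2 : Filter.Tendsto
        (fun p : G × regularProb X => ‖f.comp (smulMap X p.1) - f.comp (smulMap X g₀)‖)
        (𝓝 (g₀, Λ₀)) (𝓝 0) := by
      have := (((hF.comp continuous_fst).sub continuous_const).norm :
        Continuous fun p : G × regularProb X =>
          ‖f.comp (smulMap X p.1) - f.comp (smulMap X g₀)‖).tendsto (g₀, Λ₀)
      simpa using this
    have h3 : Filter.Tendsto
        (fun p : G × regularProb X => p.2.1 (f.comp (smulMap X p.1) - f.comp (smulMap X g₀)))
        (𝓝 (g₀, Λ₀)) (𝓝 0) :=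
      squeeze_zero_norm (fun p => abs_le_norm_of_mem_regularProb p.2.2 _) h2
    have h4 := h3.add h1
    rw [zero_add] at h4
    refine h4.congr fun p => ?_
    rw [map_sub, sub_add_cancel]

/-- The affine `G`-flow `P(X)` of regular Borel probability measures on the `G`-flow `X`, with the
weak-* topology and the action by push-forward. -/
noncomputable def probFlow : AffineFlow G where
  E := WeakDual ℝ C(X, ℝ)
  locallyConvex := inferInstanceAs (LocallyConvexSpace ℝ (WeakBilin (topDualPairing ℝ C(X, ℝ))))
  carrier := regularProb X
  isCompact := isCompact_regularProb
  convex := convex_regularProb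
  affine g Λ Θ Ξ a b _ _ _ h := by
    refine DFunLike.ext _ _ fun f => ?_
    change Ξ.1 (f.comp (smulMap X g)) =
      a * Λ.1 (f.comp (smulMap X g)) + b * Θ.1 (f.comp (smulMap X g))
    rw [h]
    rfl

end action

/-! Milman's converse of Krein–Milman turns proximal irreducibility into a statement about closed
sets: for a proximally irreducible `φ : K → L`, a closed invariant set meeting all the hulls in the
definition contains the closure of the extreme points of `K` (`mem_of_meets`). Extensions can
therefore be built from flows: an equivariant map from a flow `X` to `K` extends by barycenters to
`P(X)`, whose extreme points are the Dirac measures.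

The main lemma is `isProxIrrExtension_barycenter_of_minimal`. Given proximally irreducible `K` and
`K'` over `L`, let `W` be minimal among the closed invariant subsets of the fiber product of their
extreme closures that map onto that of `L`. A subflow of `P(W)` meeting the hulls over `K` contains,
by irreducibility of `K' → L`, a measure lying over a prescribed extreme point of `K'` and over some
Dirac measure of `K`; such a measure is itself Dirac. Minimality then forces every Dirac measure
into the subflow. So `P(W)` is a proximally irreducible extension of `K` and of `K'`; if both are
maximal, both maps are isomorphisms, which is uniqueness.

For existence, the extreme closures of all proximally irreducible extensions of `L` are quotients of
one space of ultrafilters, so a set of extensions dominates all. Take `W` minimal in the fiber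
product of that set. The main lemma and closure under composition handle finitely many factors, and
compactness the rest, so `P(W) → L` is proximally irreducible. For a further such `Q → P(W)`, the
composite to `L` is dominated, which yields a map `W → Q`; a midpoint argument (`eq_of_minimal`)
shows that it lifts the Dirac embedding, and so `Q → P(W)` is injective.

In the examples `Y` is empty or has a dense orbit, and limits of translates along ultrafilters carry
one well-placed point to all the fibers. -/

section Convexity

/-! ### Convex hulls, faces and Milman's theorem. -/

variable {E : Type*} [AddCommGroup E] [Module ℝ E] [TopologicalSpace E] [IsTopologicalAddGroup E]
  [ContinuousSMul ℝ E]

theorem isCompact_convexJoin {s t : Set E} (hs : IsCompact s) (ht : IsCompact t) :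
    IsCompact (convexJoin ℝ s t) := by
  have h : convexJoin ℝ s t =
      (fun p : (E × E) × ℝ => (1 - p.2) • p.1.1 + p.2 • p.1.2) '' ((s ×ˢ t) ×ˢ Icc (0 : ℝ) 1) := by
    ext z
    simp only [mem_convexJoin, segment_eq_image, mem_image, mem_prod]
    constructor
    · rintro ⟨x, hx, y, hy, θ, hθ, rfl⟩
      exact ⟨((x, y), θ), ⟨⟨hx, hy⟩, hθ⟩, rfl⟩
    · rintro ⟨⟨⟨x, y⟩, θ⟩, ⟨⟨hx, hy⟩, hθ⟩, rfl⟩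
      exact ⟨x, hx, y, hy, θ, hθ, rfl⟩
  rw [h]
  exact ((hs.prod ht).prod isCompact_Icc).image (by fun_prop)

theorem isCompact_convexHull_biUnion {ι : Type*} (F : Finset ι) (S : ι → Set E)
    (hc : ∀ i ∈ F, IsCompact (S i)) (hv : ∀ i ∈ F, Convex ℝ (S i)) :
    IsCompact (convexHull ℝ (⋃ i ∈ F, S i)) := by
  classical
  induction F using Finset.induction_on with
  | empty => simp
  | insert a F ha ih =>
    have ih' := ih (fun i hi => hc i (Finset.mem_insert_of_mem hi))
      (fun i hi => hv i (Finset.mem_insert_of_mem hi))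
    have ca := hc a (Finset.mem_insert_self a F)
    have va := hv a (Finset.mem_insert_self a F)
    rw [Finset.set_biUnion_insert]
    rcases (S a).eq_empty_or_nonempty with h1 | h1
    · simpa [h1] using ih'
    rcases (⋃ i ∈ F, S i).eq_empty_or_nonempty with h2 | h2
    · rw [h2, union_empty, va.convexHull_eq]
      exact ca
    rw [convexHull_union h1 h2, va.convexHull_eq]
    exact isCompact_convexJoin ca ih'

/-- Milman's partial converse of the Krein–Milman theorem. -/
theorem extremePoints_closure_convexHull_subset [LocallyConvexSpace ℝ E] [T2Space E] {T : Set E}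
    (hT : IsCompact T) (hK : IsCompact (closure (convexHull ℝ T))) :
    (closure (convexHull ℝ T)).extremePoints ℝ ⊆ T := by
  intro x hx
  by_contra hxT
  have hopen : Tᶜ ∈ 𝓝 x := hT.isClosed.isOpen_compl.mem_nhds hxT
  have hV : ∃ V : Set E, V ∈ 𝓝 (0 : E) ∧ Convex ℝ V ∧ IsClosed V ∧ ∀ v ∈ V, x - v ∉ T := by
    have h1 : (fun v => x - v) ⁻¹' Tᶜ ∈ 𝓝 (0 : E) :=
      (continuous_const.sub continuous_id).continuousAt.preimage_mem_nhds (by simpa using hopen)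
    obtain ⟨U, hU, hUc, hUs⟩ := exists_mem_nhds_isClosed_subset h1
    obtain ⟨V, ⟨hV, hVc⟩, hVs⟩ := (LocallyConvexSpace.convex_basis (𝕜 := ℝ) (0 : E)).mem_iff.1 hU
    exact ⟨closure V, Filter.mem_of_superset hV subset_closure, hVc.closure, isClosed_closure,
      fun v hv => hUs (closure_minimal hVs hUc hv)⟩
  obtain ⟨V, hV, hVc, hVcl, hVx⟩ := hV
  obtain ⟨F, hFT, hF⟩ := hT.elim_nhds_subcover (fun t => (fun y => y - t) ⁻¹' V) (fun t _ =>
    (continuous_id.sub continuous_const).continuousAt.preimage_mem_nhds (by simpa using hV))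
  -- Finitely many compact convex pieces of diameter controlled by `V` cover `T`. Their hull needs
  -- no closure, so an extreme point lies in one piece, within `V` of a point of `T`.
  set S : E → Set E := fun t => closure (convexHull ℝ T) ∩ (fun y => y - t) ⁻¹' V with hS
  have hSc : ∀ t, IsCompact (S t) := fun t =>
    hK.inter_right (hVcl.preimage (continuous_id.sub continuous_const))
  have hSv : ∀ t, Convex ℝ (S t) := fun t =>
    (convex_convexHull ℝ T).closure.inter (by
      simpa [sub_eq_add_neg] using hVc.translate_preimage_left (-t))
  have hsub : closure (convexHull ℝ T) = convexHull ℝ (⋃ t ∈ F, S t) := by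
    apply Subset.antisymm
    · refine closure_minimal (convexHull_mono fun y hy => ?_)
        (isCompact_convexHull_biUnion F S (fun i _ => hSc i) fun i _ => hSv i).isClosed
      obtain ⟨t, ht, hyt⟩ := mem_iUnion₂.1 (hF hy)
      exact mem_iUnion₂.2 ⟨t, ht, subset_closure (subset_convexHull ℝ T hy), hyt⟩
    · exact convexHull_min (iUnion₂_subset fun t _ => inter_subset_left)
        (convex_convexHull ℝ T).closure
  rw [hsub] at hx
  obtain ⟨t, ht, hxt⟩ := mem_iUnion₂.1 (extremePoints_convexHull_subset hx)
  exact hVx _ hxt.2 (by simpa using hFT t ht)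

/-- A finite convex combination that lands in a face uses only points of the face. The points `v` of
`s` for which `v ∈ B` implies `v ∈ convexHull ℝ (A ∩ B)` form a convex set containing `A`. -/
theorem IsExtreme.mem_convexHull_inter {E : Type*} [AddCommGroup E] [Module ℝ E] {s B A : Set E}
    (hB : IsExtreme ℝ s B) (hs : Convex ℝ s) (hA : A ⊆ s) {x : E} (hx : x ∈ convexHull ℝ A)
    (hxB : x ∈ B) : x ∈ convexHull ℝ (A ∩ B) := by
  have hQ : Convex ℝ {v | v ∈ s ∧ (v ∈ B → v ∈ convexHull ℝ (A ∩ B))} := by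
    rintro v ⟨hv, hv'⟩ w ⟨hw, hw'⟩ a b ha hb hab
    refine ⟨hs hv hw ha hb hab, fun h => ?_⟩
    rcases ha.eq_or_lt with rfl | ha
    · obtain rfl : b = 1 := by linarith
      simp only [zero_smul, one_smul, zero_add] at h ⊢
      exact hw' h
    rcases hb.eq_or_lt with rfl | hb
    · obtain rfl : a = 1 := by linarith
      simp only [zero_smul, one_smul, add_zero] at h ⊢
      exact hv' h
    have hseg : a • v + b • w ∈ openSegment ℝ v w := ⟨a, b, ha, hb, hab, rfl⟩
    exact convex_convexHull ℝ _ (hv' (hB.left_mem_of_mem_openSegment hv hw h hseg))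
      (hw' (hB.right_mem_of_mem_openSegment hv hw h hseg)) ha.le hb.le hab
  have hAQ : A ⊆ {v | v ∈ s ∧ (v ∈ B → v ∈ convexHull ℝ (A ∩ B))} := fun a ha =>
    ⟨hA ha, fun h => subset_convexHull ℝ _ ⟨ha, h⟩⟩
  exact (convexHull_min hAQ hQ hx).2 hxB

end Convexity

/-! ### Affine maps, their fibers and extreme points. -/

namespace PreservesConvexComb

variable {E F : Type u} [AddCommGroup E] [Module ℝ E] [AddCommGroup F] [Module ℝ F]
  {s : Set E} {t : Set F} {f : s → t}

theorem convex_image (hf : PreservesConvexComb f) (hs : Convex ℝ s) {C : Set E}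
    (hC : Convex ℝ C) : Convex ℝ (Subtype.val '' (f '' (Subtype.val ⁻¹' C))) := by
  rintro _ ⟨_, ⟨x, hx, rfl⟩, rfl⟩ _ ⟨_, ⟨y, hy, rfl⟩, rfl⟩ a b ha hb hab
  let z : s := ⟨a • (x : E) + b • (y : E), hs x.2 y.2 ha hb hab⟩
  have hz : z ∈ Subtype.val ⁻¹' C := hC hx hy ha hb hab
  exact ⟨f z, ⟨z, hz, rfl⟩, hf x y z a b ha hb hab rfl⟩

theorem convex_preimage (hf : PreservesConvexComb f) (hs : Convex ℝ s) {D : Set F}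
    (hD : Convex ℝ D) : Convex ℝ (Subtype.val '' (f ⁻¹' (Subtype.val ⁻¹' D))) := by
  rintro _ ⟨x, hx, rfl⟩ _ ⟨y, hy, rfl⟩ a b ha hb hab
  refine ⟨⟨_, hs x.2 y.2 ha hb hab⟩, ?_, rfl⟩
  change (f _ : F) ∈ D
  rw [hf x y _ a b ha hb hab rfl]
  exact hD hx hy ha hb hab

theorem convex_fiber (hf : PreservesConvexComb f) (hs : Convex ℝ s) (y : t) :
    Convex ℝ (Subtype.val '' (f ⁻¹' {y})) := by
  have := hf.convex_preimage hs (convex_singleton (𝕜 := ℝ) (y : F))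
  rwa [show (Subtype.val ⁻¹' {(y : F)} : Set t) = {y} by ext; simp [Subtype.ext_iff]] at this

theorem map_mem_convexHull (hf : PreservesConvexComb f) (hs : Convex ℝ s) {A : Set s} {x : s}
    (hx : (x : E) ∈ convexHull ℝ (Subtype.val '' A)) :
    (f x : F) ∈ convexHull ℝ (Subtype.val '' (f '' A)) := by
  have h := convexHull_min (𝕜 := ℝ) (s := Subtype.val '' A)
    (t := Subtype.val '' (f ⁻¹' (Subtype.val ⁻¹' convexHull ℝ (Subtype.val '' (f '' A))))) ?_
    (hf.convex_preimage hs (convex_convexHull ℝ _)) hx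
  · obtain ⟨y, hy, hyx⟩ := h
    rwa [← Subtype.ext hyx]
  · rintro _ ⟨y, hy, rfl⟩
    exact ⟨y, subset_convexHull ℝ _ ⟨_, ⟨y, hy, rfl⟩, rfl⟩, rfl⟩

/-- The preimage of an extreme point is an extreme set. -/
theorem isExtreme_preimage (hf : PreservesConvexComb f) {y : t}
    (hy : (y : F) ∈ t.extremePoints ℝ) : IsExtreme ℝ s (Subtype.val '' (f ⁻¹' {y})) := by
  refine ⟨Subtype.coe_image_subset _ _, ?_⟩
  rintro x₁ h₁ x₂ h₂ _ ⟨x, hx, rfl⟩ ⟨a, b, ha, hb, hab, hxab⟩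
  refine ⟨⟨x₁, h₁⟩, Subtype.ext (hy.2 (f ⟨x₁, h₁⟩).2 (f ⟨x₂, h₂⟩).2 ?_), rfl⟩
  refine ⟨a, b, ha, hb, hab, ?_⟩
  rw [← hf ⟨x₁, h₁⟩ ⟨x₂, h₂⟩ x a b ha.le hb.le hab hxab.symm, show f x = y from hx]

/-- The fiber over an extreme point is a face. This localizes a hull over a large set to the hull
over one fiber. -/
theorem mem_convexHull_fiber (hf : PreservesConvexComb f) (hs : Convex ℝ s) {A : Set s} {x : s}
    (hx : (x : E) ∈ convexHull ℝ (Subtype.val '' A)) (hfx : (f x : F) ∈ t.extremePoints ℝ) :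
    (x : E) ∈ convexHull ℝ (Subtype.val '' {z | z ∈ A ∧ f z = f x}) := by
  refine convexHull_mono ?_ ((hf.isExtreme_preimage hfx).mem_convexHull_inter hs
    (Subtype.coe_image_subset _ _) hx ⟨x, rfl, rfl⟩)
  rintro _ ⟨⟨z, hz, rfl⟩, ⟨z', hz', hzz⟩⟩
  obtain rfl : z' = z := Subtype.ext hzz
  exact ⟨z', ⟨hz, hz'⟩, rfl⟩

end PreservesConvexComb

section

variable {E F : Type u} [AddCommGroup E] [Module ℝ E] [TopologicalSpace E]
  [IsTopologicalAddGroup E] [ContinuousSMul ℝ E] [LocallyConvexSpace ℝ E] [T2Space E]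
  [AddCommGroup F] [Module ℝ F] [TopologicalSpace F] [T2Space F] {s : Set E} {t : Set F} {f : s → t}

/-- An extreme point in the range of a continuous affine map is the image of an extreme point. -/
theorem PreservesConvexComb.exists_extremePoint (hf : PreservesConvexComb f) (hs : IsCompact s)
    (hc : Continuous f) {y : t} (hy : (y : F) ∈ t.extremePoints ℝ) (hr : y ∈ range f) :
    ∃ x : s, (x : E) ∈ s.extremePoints ℝ ∧ f x = y := by
  obtain ⟨x, rfl⟩ := hr
  have : CompactSpace s := isCompact_iff_compactSpace.1 hs
  obtain ⟨z, hz⟩ := ((isClosed_singleton.preimage hc).isCompact.image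
    continuous_subtype_val).extremePoints_nonempty ⟨x, x, rfl, rfl⟩
  obtain ⟨z', hz', rfl⟩ := hz.1
  exact ⟨z', (hf.isExtreme_preimage hy).extremePoints_subset_extremePoints hz, hz'⟩

end

/-! ### Flows, and the closure of the extreme points as a flow. -/

namespace GFlow

variable {G : Type u} [Group G] [TopologicalSpace G]

/-- A closed invariant subset of a flow, as a flow. -/
def sub (X : GFlow G) (T : Set X) (hT : IsClosed T)
    (hinv : ∀ (g : G) (x : X), x ∈ T → g • x ∈ T) : GFlow G :=
  letI : MulAction G T :=
    { smul := fun g x => ⟨g • x.1, hinv g x.1 x.2⟩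
      one_smul := fun x => Subtype.ext (one_smul G x.1)
      mul_smul := fun g h x => Subtype.ext (mul_smul g h x.1) }
  { carrier := T
    compact := isCompact_iff_compactSpace.1 hT.isCompact
    cont := ⟨Continuous.subtype_mk
      (continuous_fst.smul (continuous_subtype_val.comp continuous_snd)) _⟩ }

/-- The product of two flows. -/
@[reducible] def prod (X Y : GFlow G) : GFlow G where
  carrier := X × Y

/-- The product of a family of flows. -/
@[reducible] def pi {ι : Type u} (X : ι → GFlow G) : GFlow G where
  carrier := ∀ i, X i

end GFlow

namespace AffineFlow

variable {G : Type u} [Group G] [TopologicalSpace G]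

instance (K : AffineFlow G) : CompactSpace K := isCompact_iff_compactSpace.1 K.isCompact

/-- The flow underlying an affine flow. -/
def toGFlow (K : AffineFlow G) : GFlow G where
  carrier := K

section

variable {K L : AffineFlow G}

theorem mem_of_mem_extClosure {D : Set K} (hD : IsClosed D)
    (h : ∀ x : K, (x : K.E) ∈ K.carrier.extremePoints ℝ → x ∈ D) {x : K}
    (hx : (x : K.E) ∈ K.extClosure) : x ∈ D := by
  have h1 : K.extClosure ⊆ Subtype.val '' D :=
    closure_minimal (fun y hy => ⟨⟨y, hy.1⟩, h _ hy, rfl⟩)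
      (hD.isCompact.image continuous_subtype_val).isClosed
  obtain ⟨y, hy, hyx⟩ := h1 hx
  rwa [← Subtype.ext hyx]

theorem isClosed_mem_extClosure (K : AffineFlow G) :
    IsClosed {x : K | (x : K.E) ∈ K.extClosure} :=
  isClosed_closure.preimage continuous_subtype_val

/-- The singleton of `g • x` is the fiber of the affine map `g⁻¹ • ·` over an extreme point, hence a
face. -/
theorem smul_mem_extremePoints (g : G) {x : K} (hx : (x : K.E) ∈ K.carrier.extremePoints ℝ) :
    ((g • x : K) : K.E) ∈ K.carrier.extremePoints ℝ := by
  have h := (K.affine g⁻¹).isExtreme_preimage (y := x) hx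
  have h2 : (fun x : K => g⁻¹ • x) ⁻¹' {x} = {g • x} := by
    ext z
    simp [inv_smul_eq_iff]
  rw [h2, image_singleton, isExtreme_singleton] at h
  exact h

theorem smul_mem_extClosure (g : G) {x : K} (hx : (x : K.E) ∈ K.extClosure) :
    ((g • x : K) : K.E) ∈ K.extClosure :=
  mem_of_mem_extClosure (D := (fun x => g • x) ⁻¹' {x : K | (x : K.E) ∈ K.extClosure})
    (K.isClosed_mem_extClosure.preimage (continuous_const_smul g))
    (fun _ hx => subset_closure (smul_mem_extremePoints g hx)) hx

/-- The closure of the set of extreme points, as a flow. -/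
def extFlow (K : AffineFlow G) : GFlow G :=
  K.toGFlow.sub {x : K | (x : K.E) ∈ K.extClosure} K.isClosed_mem_extClosure
    fun g _ hx => smul_mem_extClosure g hx

/-- The inclusion of the closure of the set of extreme points. -/
def extIncl (K : AffineFlow G) (x : K.extFlow) : K := x.1

/-- A point of the closure of the set of extreme points, as an element of the flow. -/
def toExtFlow (x : K) (hx : (x : K.E) ∈ K.extClosure) : K.extFlow := ⟨x, hx⟩

theorem extIncl_mem (x : K.extFlow) : (K.extIncl x : K.E) ∈ K.extClosure := x.2

theorem extIncl_injective : Function.Injective K.extIncl := fun _ _ h => Subtype.ext h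

theorem extIncl_smul (g : G) (x : K.extFlow) : K.extIncl (g • x) = g • K.extIncl x := rfl

theorem continuous_extIncl : Continuous K.extIncl := continuous_subtype_val

theorem continuous_extFlow_iff {Y : Type*} [TopologicalSpace Y] {f : Y → K.extFlow} :
    Continuous f ↔ Continuous (K.extIncl ∘ f) := continuous_induced_rng

theorem isAffineSubflow_hull {T : Set K} (hne : T.Nonempty)
    (hinv : ∀ (g : G) (x : K), x ∈ T → g • x ∈ T) :
    K.IsAffineSubflow (closure (convexHull ℝ (Subtype.val '' T))) := by
  have hsub : closure (convexHull ℝ (Subtype.val '' T)) ⊆ K.carrier :=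
    closure_minimal (convexHull_min (Subtype.coe_image_subset _ _) K.convex) K.isCompact.isClosed
  refine ⟨hsub, ?_, K.isCompact.of_isClosed_subset isClosed_closure hsub,
    (convex_convexHull ℝ _).closure, fun g x hx => ?_⟩
  · exact ((hne.image _).mono (subset_convexHull ℝ _)).mono subset_closure
  · set C := closure (convexHull ℝ (Subtype.val '' T)) with hC
    have h1 : C ⊆ Subtype.val '' ((fun x : K => g • x) ⁻¹' (Subtype.val ⁻¹' C)) := by
      refine closure_minimal (convexHull_min ?_
        ((K.affine g).convex_preimage K.convex (convex_convexHull ℝ _).closure)) ?_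
      · rintro _ ⟨y, hy, rfl⟩
        exact ⟨y, subset_closure (subset_convexHull ℝ _ ⟨_, hinv g y hy, rfl⟩), rfl⟩
      · exact ((isClosed_closure.preimage
          (continuous_subtype_val.comp (continuous_const_smul g))).isCompact.image
          continuous_subtype_val).isClosed
    obtain ⟨y, hy, hyx⟩ := h1 hx
    rwa [← Subtype.ext hyx]

/-- Milman's theorem: a closed set that generates `K` contains its extreme points. -/
theorem mem_of_hull_eq_carrier {T : Set K} (hT : IsClosed T)
    (h : closure (convexHull ℝ (Subtype.val '' T)) = K.carrier) {x : K}
    (hx : (x : K.E) ∈ K.carrier.extremePoints ℝ) : x ∈ T := by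
  have h1 := extremePoints_closure_convexHull_subset
    (hT.isCompact.image continuous_subtype_val) (by rw [h]; exact K.isCompact)
  rw [h] at h1
  obtain ⟨y, hy, hyx⟩ := h1 hx
  rwa [← Subtype.ext hyx]

theorem IsAffineSubflow.eq_carrier {C : Set K.E} (hC : K.IsAffineSubflow C)
    (h : ∀ x : K, (x : K.E) ∈ K.carrier.extremePoints ℝ → (x : K.E) ∈ C) : C = K.carrier := by
  refine hC.subset.antisymm ?_
  rw [← closure_convexHull_extremePoints K.isCompact K.convex]
  exact closure_minimal (convexHull_min (fun x hx => h ⟨x, hx.1⟩ hx) hC.convex)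
    hC.isCompact.isClosed

namespace IsAffineExtension

variable {φ : K → L}

theorem exists_extremePoint (hφ : IsAffineExtension φ) {y : L}
    (hy : (y : L.E) ∈ L.carrier.extremePoints ℝ) :
    ∃ x : K, (x : K.E) ∈ K.carrier.extremePoints ℝ ∧ φ x = y :=
  hφ.affine.exists_extremePoint K.isCompact hφ.continuous hy (hφ.surjective y)

theorem exists_mem_extClosure (hφ : IsAffineExtension φ) {y : L}
    (hy : (y : L.E) ∈ L.extClosure) : ∃ x : K, (x : K.E) ∈ K.extClosure ∧ φ x = y := by
  refine mem_of_mem_extClosure (D := φ '' {x : K | (x : K.E) ∈ K.extClosure})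
    (K.isClosed_mem_extClosure.isCompact.image hφ.continuous).isClosed (fun y hy => ?_) hy
  obtain ⟨x, hx, hxy⟩ := hφ.exists_extremePoint hy
  exact ⟨x, subset_closure hx, hxy⟩

theorem comp {P : AffineFlow G} {ψ : P → K} (hφ : IsAffineExtension φ)
    (hψ : IsAffineExtension ψ) : IsAffineExtension (φ ∘ ψ) where
  continuous := hφ.continuous.comp hψ.continuous
  map_smul g x := by simp [hφ.map_smul, hψ.map_smul]
  affine x y z a b ha hb hab h :=
    hφ.affine _ _ _ a b ha hb hab (hψ.affine x y z a b ha hb hab h)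
  surjective := hφ.surjective.comp hψ.surjective

end IsAffineExtension

namespace IsProxIrrExtension

variable {φ : K → L}

/-- A closed invariant set that meets the convex hulls of all the fibers contains the extreme
points. -/
theorem mem_of_meets (hφ : IsProxIrrExtension φ) {T : Set K} (hT : IsClosed T)
    (hinv : ∀ (g : G) (x : K), x ∈ T → g • x ∈ T)
    (h : ∀ y : L, (y : L.E) ∈ L.extClosure → ∃ x ∈ T, (x : K.E) ∈
      convexHull ℝ (Subtype.val '' {x : K | (x : K.E) ∈ K.extClosure ∧ φ x = y}))
    {x : K} (hx : (x : K.E) ∈ K.extClosure) : x ∈ T := by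
  refine mem_of_mem_extClosure hT (fun x hx => ?_) hx
  have hne : T.Nonempty := by
    obtain ⟨y, hy⟩ := L.isCompact.extremePoints_nonempty ⟨φ x, (φ x).2⟩
    obtain ⟨x, hx, -⟩ := h ⟨y, hy.1⟩ (subset_closure hy)
    exact ⟨x, hx⟩
  have := hφ.eq_of_meets _ (isAffineSubflow_hull hne hinv) fun y hy => by
    obtain ⟨x, hxT, hx⟩ := h y hy
    exact ⟨x, subset_closure (subset_convexHull ℝ _ ⟨x, hxT, rfl⟩), hx⟩
  exact mem_of_hull_eq_carrier hT this hx

theorem mem_of_surjOn (hφ : IsProxIrrExtension φ) {T : Set K} (hT : IsClosed T)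
    (hinv : ∀ (g : G) (x : K), x ∈ T → g • x ∈ T)
    (h : ∀ y : L, (y : L.E) ∈ L.extClosure → ∃ x ∈ T, (x : K.E) ∈ K.extClosure ∧ φ x = y)
    {x : K} (hx : (x : K.E) ∈ K.extClosure) : x ∈ T :=
  hφ.mem_of_meets hT hinv (fun y hy => by
    obtain ⟨x, hxT, hx⟩ := h y hy
    exact ⟨x, hxT, subset_convexHull ℝ _ ⟨x, hx, rfl⟩⟩) hx

/-- The preimage of `extClosure L` is closed and invariant, and contains points of `extClosure K`
over every point of `extClosure L`; irreducibility does the rest. -/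
theorem map_mem_extClosure (hφ : IsProxIrrExtension φ) {x : K} (hx : (x : K.E) ∈ K.extClosure) :
    ((φ x : L) : L.E) ∈ L.extClosure :=
  hφ.mem_of_surjOn (T := φ ⁻¹' {y : L | (y : L.E) ∈ L.extClosure})
    (L.isClosed_mem_extClosure.preimage hφ.continuous)
    (fun g x hx => by
      simp only [mem_preimage, mem_ofPred_eq, hφ.map_smul] at hx ⊢
      exact smul_mem_extClosure g hx)
    (fun y hy => by
      obtain ⟨x, hx, rfl⟩ := hφ.exists_mem_extClosure hy
      exact ⟨x, hy, hx, rfl⟩) hx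

end IsProxIrrExtension

end

end AffineFlow

/-! ### The affine flow `P(X)` and its Dirac measures. -/

section ProbFlow

variable {G : Type u} [Group G] [TopologicalSpace G] {X : GFlow G}

/-- Integration of a continuous function against an element of `P(X)`. -/
noncomputable def probEval (Λ : probFlow X) (f : C(X, ℝ)) : ℝ :=
  (show WeakDual ℝ C(X, ℝ) from Λ.1) f

theorem probEval_ext {Λ Θ : probFlow X} (h : ∀ f, probEval Λ f = probEval Θ f) : Λ = Θ :=
  Subtype.ext (DFunLike.ext (F := WeakDual ℝ C(X, ℝ)) _ _ h)

theorem continuous_probEval (f : C(X, ℝ)) : Continuous fun Λ : probFlow X => probEval Λ f :=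
  (WeakDual.eval_continuous f).comp continuous_subtype_val

theorem probEval_convexComb {Λ Θ Ξ : probFlow X} {a b : ℝ}
    (h : (Ξ : (probFlow X).E) = a • (Λ : (probFlow X).E) + b • (Θ : (probFlow X).E))
    (f : C(X, ℝ)) : probEval Ξ f = a * probEval Λ f + b * probEval Θ f :=
  DFunLike.congr_fun (F := WeakDual ℝ C(X, ℝ)) h f

theorem probEval_nonneg (Λ : probFlow X) {f : C(X, ℝ)} (hf : 0 ≤ f) : 0 ≤ probEval Λ f :=
  ((mem_regularProb_iff _).1 Λ.2).1 f hf

theorem probEval_one (Λ : probFlow X) : probEval Λ 1 = 1 :=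
  ((mem_regularProb_iff _).1 Λ.2).2

theorem probEval_sub (Λ : probFlow X) (f g : C(X, ℝ)) :
    probEval Λ (f - g) = probEval Λ f - probEval Λ g :=
  map_sub (show WeakDual ℝ C(X, ℝ) from Λ.1) f g

theorem probEval_const (Λ : probFlow X) (c : ℝ) :
    probEval Λ (ContinuousMap.const X c) = c := by
  have h : ContinuousMap.const X c = c • (1 : C(X, ℝ)) := by ext; simp
  rw [h]
  exact (map_smul (show WeakDual ℝ C(X, ℝ) from Λ.1) c 1).trans (by
    rw [smul_eq_mul]
    exact (congrArg _ (probEval_one Λ)).trans (mul_one c))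

theorem probEval_mono (Λ : probFlow X) {f g : C(X, ℝ)} (h : f ≤ g) :
    probEval Λ f ≤ probEval Λ g := by
  have := probEval_nonneg Λ (sub_nonneg.2 h)
  rw [probEval_sub] at this
  linarith

/-- The Dirac measure at a point. -/
noncomputable def diracProb (X : GFlow G) (x : X) : probFlow X :=
  ⟨StrongDual.toWeakDual (ContinuousMap.evalCLM ℝ x),
    (mem_regularProb_iff _).2 ⟨fun _ hf => hf x, rfl⟩⟩

theorem probEval_dirac (x : X) (f : C(X, ℝ)) : probEval (diracProb X x) f = f x := rfl

theorem continuous_diracProb : Continuous (diracProb X) :=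
  Continuous.subtype_mk (WeakDual.continuous_of_continuous_eval fun f => f.continuous) _

theorem diracProb_smul (g : G) (x : X) : diracProb X (g • x) = g • diracProb X x :=
  probEval_ext fun _ => rfl

theorem diracProb_injective : Function.Injective (diracProb X) := by
  intro x y h
  by_contra hxy
  obtain ⟨f, hf0, hf1, -⟩ := exists_continuous_zero_one_of_isClosed (isClosed_singleton (x := x))
    (isClosed_singleton (x := y)) (by simpa using hxy)
  have := congrArg (fun Λ => probEval Λ f) h
  simp only [probEval_dirac] at this
  rw [hf0 rfl, hf1 rfl] at this
  simp at this

/-- Hahn–Banach: a separating weak-* functional is evaluation at some `f`. A bound `r` on it at all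
Dirac measures says `f ≤ r`, which bounds every integral of `f` by `r`. -/
theorem closure_convexHull_range_diracProb :
    closure (convexHull ℝ (Subtype.val '' range (diracProb X))) = (probFlow X).carrier := by
  apply Subset.antisymm
  · exact closure_minimal (convexHull_min (Subtype.coe_image_subset _ _) (probFlow X).convex)
      (probFlow X).isCompact.isClosed
  intro Λ hΛ
  by_contra hn
  obtain ⟨l, r, hlr, hr⟩ :=
    geometric_hahn_banach_closed_point (convex_convexHull ℝ _).closure isClosed_closure hn
  obtain ⟨f, hf⟩ := LinearMap.dualEmbedding_surjective (topDualPairing ℝ C(X, ℝ)) l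
  have hl : ∀ Θ : probFlow X, l Θ.1 = probEval Θ f := fun Θ => by rw [← hf]; rfl
  have h1 : f ≤ ContinuousMap.const X r := fun x => by
    have := hlr _ (subset_closure (subset_convexHull ℝ _ ⟨_, ⟨x, rfl⟩, rfl⟩))
    rw [hl, probEval_dirac] at this
    exact this.le
  have h2 := probEval_mono ⟨Λ, hΛ⟩ h1
  rw [probEval_const, ← hl] at h2
  exact absurd h2 (not_le.2 hr)

theorem diracProb_mem_extremePoints (x : X) :
    (diracProb X x : (probFlow X).E) ∈ (probFlow X).carrier.extremePoints ℝ := by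
  refine ⟨(diracProb X x).2, ?_⟩
  rintro Λ₁ h₁ Λ₂ h₂ ⟨a, b, ha, hb, hab, h⟩
  have key := probEval_convexComb (Λ := ⟨Λ₁, h₁⟩) (Θ := ⟨Λ₂, h₂⟩) h.symm
  refine congrArg Subtype.val (probEval_ext (Λ := ⟨Λ₁, h₁⟩) (Θ := diracProb X x) fun f => ?_)
  -- The function `|f - f x|` integrates to `0` against the Dirac measure, hence against each
  -- component of positive weight.
  set c := ContinuousMap.const X (f x) with hc
  have hk := key |f - c|
  have h0 : probEval (diracProb X x) |f - c| = 0 := by simp [probEval_dirac, hc]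
  rw [h0] at hk
  have p1 := probEval_nonneg (⟨Λ₁, h₁⟩ : probFlow X) (abs_nonneg (f - c))
  have p2 := probEval_nonneg (⟨Λ₂, h₂⟩ : probFlow X) (abs_nonneg (f - c))
  have h3 : probEval (⟨Λ₁, h₁⟩ : probFlow X) |f - c| = 0 := by
    nlinarith [mul_nonneg ha.le p1, mul_nonneg hb.le p2]
  have h4 := probEval_mono (⟨Λ₁, h₁⟩ : probFlow X) (le_abs_self (f - c))
  have h5 := probEval_mono (⟨Λ₁, h₁⟩ : probFlow X) (neg_le_abs (f - c))
  rw [neg_sub, probEval_sub] at h5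
  rw [probEval_sub] at h4
  rw [probEval_dirac]
  have h6 := probEval_const (⟨Λ₁, h₁⟩ : probFlow X) (f x)
  rw [← hc] at h6
  linarith

theorem isClosed_range_diracProb : IsClosed (range (diracProb X)) :=
  (isCompact_range continuous_diracProb).isClosed

theorem mem_range_diracProb_of_mem_extremePoints {Λ : probFlow X}
    (h : (Λ : (probFlow X).E) ∈ (probFlow X).carrier.extremePoints ℝ) : Λ ∈ range (diracProb X) :=
  AffineFlow.mem_of_hull_eq_carrier isClosed_range_diracProb closure_convexHull_range_diracProb h

theorem mem_extClosure_probFlow {Λ : probFlow X} :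
    (Λ : (probFlow X).E) ∈ (probFlow X).extClosure ↔ Λ ∈ range (diracProb X) := by
  refine ⟨AffineFlow.mem_of_mem_extClosure isClosed_range_diracProb
    fun _ h => mem_range_diracProb_of_mem_extremePoints h, ?_⟩
  rintro ⟨x, rfl⟩
  exact subset_closure (diracProb_mem_extremePoints x)

theorem mem_of_diracProb_mem {D : Set (probFlow X)} (hD : IsClosed D)
    (hv : Convex ℝ (Subtype.val '' D)) (h : ∀ x, diracProb X x ∈ D) (Λ : probFlow X) : Λ ∈ D := by
  have h1 : (probFlow X).carrier ⊆ Subtype.val '' D := by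
    refine closure_convexHull_range_diracProb.symm.subset.trans
      (closure_minimal (convexHull_min ?_ hv) (hD.isCompact.image continuous_subtype_val).isClosed)
    rintro _ ⟨_, ⟨x, rfl⟩, rfl⟩
    exact ⟨_, h x, rfl⟩
  obtain ⟨y, hy, hyx⟩ := h1 Λ.2
  rwa [← Subtype.ext hyx]

theorem probFlow_map_ext {F : Type u} [AddCommGroup F] [Module ℝ F] [TopologicalSpace F]
    [T2Space F] {t : Set F} {φ ψ : probFlow X → t} (hφ : Continuous φ) (hψ : Continuous ψ)
    (hφa : PreservesConvexComb φ) (hψa : PreservesConvexComb ψ)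
    (h : ∀ x, φ (diracProb X x) = ψ (diracProb X x)) : φ = ψ := by
  funext Λ
  refine mem_of_diracProb_mem (D := {Λ | φ Λ = ψ Λ}) (isClosed_eq hφ hψ) ?_ h Λ
  rintro _ ⟨Λ, hΛ, rfl⟩ _ ⟨Θ, hΘ, rfl⟩ a b ha hb hab
  refine ⟨⟨_, (probFlow X).convex Λ.2 Θ.2 ha hb hab⟩, Subtype.ext ?_, rfl⟩
  rw [hφa Λ Θ _ a b ha hb hab rfl, hψa Λ Θ _ a b ha hb hab rfl, show φ Λ = ψ Λ from hΛ,
    show φ Θ = ψ Θ from hΘ]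

/-- A measure in a closed face containing at most one Dirac measure is that Dirac measure. -/
theorem exists_diracProb_mem_face {B : Set (probFlow X)} (hB : IsClosed B)
    (hBe : IsExtreme ℝ (probFlow X).carrier (Subtype.val '' B))
    (hBv : Convex ℝ (Subtype.val '' B)) {Λ : probFlow X} (hΛ : Λ ∈ B)
    (hu : ∀ x y, diracProb X x ∈ B → diracProb X y ∈ B → x = y) :
    ∃ x, Λ = diracProb X x := by
  have hc : IsCompact (Subtype.val '' B) := hB.isCompact.image continuous_subtype_val
  -- Extreme points of the face are extreme in `P(X)`, so they are Dirac measures. There is only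
  -- one, and Krein–Milman collapses the face to it.
  have hd : ∀ Θ ∈ (Subtype.val '' B).extremePoints ℝ,
      ∃ x, diracProb X x ∈ B ∧ (diracProb X x : (probFlow X).E) = Θ := by
    intro Θ hΘ
    obtain ⟨Θ', hΘ', rfl⟩ := hΘ.1
    obtain ⟨x, rfl⟩ :=
      mem_range_diracProb_of_mem_extremePoints (hBe.extremePoints_subset_extremePoints hΘ)
    exact ⟨x, hΘ', rfl⟩
  obtain ⟨Θ, hΘ⟩ := hc.extremePoints_nonempty ⟨_, Λ, hΛ, rfl⟩
  obtain ⟨x, hx, rfl⟩ := hd Θ hΘ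
  have hs : (Subtype.val '' B).extremePoints ℝ = {(diracProb X x : (probFlow X).E)} := by
    refine eq_singleton_iff_unique_mem.2 ⟨hΘ, fun Θ' hΘ' => ?_⟩
    obtain ⟨y, hy, rfl⟩ := hd Θ' hΘ'
    rw [hu y x hy hx]
  have hB' := closure_convexHull_extremePoints hc hBv
  rw [hs, convexHull_singleton, closure_singleton] at hB'
  have : (Λ : (probFlow X).E) ∈ ({(diracProb X x : (probFlow X).E)} : Set _) := by
    rw [hB']
    exact ⟨Λ, hΛ, rfl⟩
  exact ⟨x, Subtype.ext this⟩

/-! ### Barycenters: extending maps of flows to affine maps on `P(X)`. -/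

section Barycenter

variable {K : AffineFlow G} {f : X → K}

/-- Composition of a continuous linear functional with a map into an affine flow. -/
def functionalComp (hf : Continuous f) (l : StrongDual ℝ K.E) : C(X, ℝ) :=
  ⟨fun x => l (f x), l.continuous.comp (continuous_subtype_val.comp hf)⟩

/-- The relation "`k` represents `Λ`" is closed and stable under convex combinations, and it holds
between `f x` and the Dirac measure at `x`. By compactness its projection to `P(X)` is closed, hence
everything. -/
theorem exists_barycenter (hf : Continuous f) (Λ : probFlow X) :
    ∃ k : K, ∀ l : StrongDual ℝ K.E, l k = probEval Λ (functionalComp hf l) := by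
  set R : Set (probFlow X × K) :=
    {p | ∀ l : StrongDual ℝ K.E, l p.2 = probEval p.1 (functionalComp hf l)} with hR
  have hRc : IsClosed R := by
    have : R = ⋂ l : StrongDual ℝ K.E, {p | l p.2 = probEval p.1 (functionalComp hf l)} := by
      ext; simp [hR]
    rw [this]
    exact isClosed_iInter fun l => isClosed_eq
      (l.continuous.comp (continuous_subtype_val.comp continuous_snd))
      ((continuous_probEval _).comp continuous_fst)
  have := mem_of_diracProb_mem (D := Prod.fst '' R) (hRc.isCompact.image continuous_fst).isClosed ?_
    (fun x => ⟨(diracProb X x, f x), fun l => rfl, rfl⟩) Λ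
  · obtain ⟨⟨Λ', k⟩, h, rfl⟩ := this
    exact ⟨k, h⟩
  rintro _ ⟨_, ⟨⟨Λ, k⟩, hk, rfl⟩, rfl⟩ _ ⟨_, ⟨⟨Θ, m⟩, hm, rfl⟩, rfl⟩ a b ha hb hab
  refine ⟨⟨_, (probFlow X).convex Λ.2 Θ.2 ha hb hab⟩,
    ⟨(⟨_, (probFlow X).convex Λ.2 Θ.2 ha hb hab⟩, ⟨_, K.convex k.2 m.2 ha hb hab⟩),
      fun l => ?_, rfl⟩, rfl⟩
  rw [probEval_convexComb (Λ := Λ) (Θ := Θ) (a := a) (b := b) rfl, ← hk l, ← hm l]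
  simp

/-- The barycenter map: the continuous affine extension of `f` to `P(X)`. -/
noncomputable def barycenter (hf : Continuous f) (Λ : probFlow X) : K :=
  (exists_barycenter hf Λ).choose

theorem barycenter_spec (hf : Continuous f) (Λ : probFlow X) (l : StrongDual ℝ K.E) :
    l (barycenter hf Λ) = probEval Λ (functionalComp hf l) :=
  (exists_barycenter hf Λ).choose_spec l

theorem eq_barycenter (hf : Continuous f) {Λ : probFlow X} {k : K}
    (h : ∀ l : StrongDual ℝ K.E, l k = probEval Λ (functionalComp hf l)) :
    k = barycenter hf Λ := by
  by_contra hne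
  obtain ⟨l, hl⟩ := geometric_hahn_banach_point_point (fun h => hne (Subtype.ext h))
  rw [h, barycenter_spec] at hl
  exact lt_irrefl _ hl

theorem barycenter_dirac (hf : Continuous f) (x : X) : barycenter hf (diracProb X x) = f x :=
  (eq_barycenter hf fun _ => rfl).symm

/-- The graph is closed and the target compact. -/
theorem continuous_barycenter (hf : Continuous f) : Continuous (barycenter hf) := by
  rw [continuous_iff_isClosed]
  intro D hD
  have : barycenter hf ⁻¹' D = Prod.fst '' ((⋂ l : StrongDual ℝ K.E,
      {p : probFlow X × K | l p.2 = probEval p.1 (functionalComp hf l)}) ∩ Prod.snd ⁻¹' D) := by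
    ext Λ
    constructor
    · exact fun h => ⟨(Λ, barycenter hf Λ), ⟨mem_iInter.2 fun l => barycenter_spec hf Λ l, h⟩, rfl⟩
    · rintro ⟨⟨Λ, k⟩, ⟨h1, h2⟩, rfl⟩
      change barycenter hf Λ ∈ D
      rw [← eq_barycenter hf (fun l => mem_iInter.1 h1 l)]
      exact h2
  rw [this]
  refine (IsClosed.isCompact (IsClosed.inter (isClosed_iInter fun l => isClosed_eq
      (l.continuous.comp (continuous_subtype_val.comp continuous_snd))
      ((continuous_probEval _).comp continuous_fst)) ?_) |>.image continuous_fst).isClosed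
  exact hD.preimage continuous_snd

theorem preservesConvexComb_barycenter (hf : Continuous f) :
    PreservesConvexComb (barycenter hf) := by
  intro Λ Θ Ξ a b ha hb hab h
  have := eq_barycenter hf (Λ := Ξ)
    (k := ⟨_, K.convex (barycenter hf Λ).2 (barycenter hf Θ).2 ha hb hab⟩) fun l => by
      rw [probEval_convexComb h, ← barycenter_spec, ← barycenter_spec]
      simp
  rw [← this]

theorem barycenter_smul (hf : Continuous f) (hfg : ∀ (g : G) (x : X), f (g • x) = g • f x) (g : G)
    (Λ : probFlow X) : barycenter hf (g • Λ) = g • barycenter hf Λ := by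
  refine congrFun (probFlow_map_ext (φ := fun Λ => barycenter hf (g • Λ))
    (ψ := fun Λ => g • barycenter hf Λ) ((continuous_barycenter hf).comp (continuous_const_smul g))
    ((continuous_const_smul g).comp (continuous_barycenter hf)) ?_ ?_ fun x => ?_) Λ
  · intro Λ Θ Ξ a b ha hb hab h
    exact preservesConvexComb_barycenter hf _ _ _ a b ha hb hab
      ((probFlow X).affine g _ _ _ a b ha hb hab h)
  · intro Λ Θ Ξ a b ha hb hab h
    exact K.affine g _ _ _ a b ha hb hab
      (preservesConvexComb_barycenter hf _ _ _ a b ha hb hab h)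
  · rw [← diracProb_smul, barycenter_dirac, barycenter_dirac, hfg]

theorem isAffineExtension_barycenter (hf : Continuous f)
    (hfg : ∀ (g : G) (x : X), f (g • x) = g • f x)
    (hr : ∀ k : K, (k : K.E) ∈ K.carrier.extremePoints ℝ → k ∈ range f) :
    AffineFlow.IsAffineExtension (barycenter hf) where
  continuous := continuous_barycenter hf
  map_smul := barycenter_smul hf hfg
  affine := preservesConvexComb_barycenter hf
  surjective := by
    have h : K.carrier ⊆ Subtype.val '' range (barycenter hf) := by
      refine (closure_convexHull_extremePoints K.isCompact K.convex).symm.subset.trans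
        (closure_minimal (convexHull_min ?_ ?_)
          ((isCompact_range (continuous_barycenter hf)).image continuous_subtype_val).isClosed)
      · intro k hk
        obtain ⟨x, hx⟩ := hr ⟨k, hk.1⟩ hk
        exact ⟨⟨k, hk.1⟩, ⟨diracProb X x, by rw [barycenter_dirac, hx]⟩, rfl⟩
      · have := (preservesConvexComb_barycenter hf).convex_image (probFlow X).convex
          (probFlow X).convex
        rwa [Subtype.coe_preimage_self, image_univ] at this
    intro k
    obtain ⟨k', hk', hkk⟩ := h k.2
    rwa [← Subtype.ext hkk]

end Barycenter

end ProbFlow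

/-! ### The main lemma: minimal flows in a fiber product. -/

namespace AffineFlow

variable {G : Type u} [Group G] [TopologicalSpace G]

theorem IsAffineSubflow.isClosed_preimage {K : AffineFlow G} {C : Set K.E}
    (hC : K.IsAffineSubflow C) : IsClosed {x : K | (x : K.E) ∈ C} :=
  hC.isCompact.isClosed.preimage continuous_subtype_val

theorem IsAffineSubflow.eq_carrier_of_diracProb_mem {X : GFlow G} {C : Set (probFlow X).E}
    (hC : (probFlow X).IsAffineSubflow C) (h : ∀ x, (diracProb X x : (probFlow X).E) ∈ C) :
    C = (probFlow X).carrier :=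
  hC.eq_carrier fun Λ hΛ => by
    obtain ⟨x, rfl⟩ := mem_range_diracProb_of_mem_extremePoints hΛ
    exact h x

/-- Only one Dirac measure lies over each point of `extClosure K`, so the hull in the definition is
a single point, and `C` contains all Dirac measures. -/
theorem isProxIrrExtension_barycenter_extFlow (K : AffineFlow G) :
    IsProxIrrExtension (K := probFlow K.extFlow) (L := K)
      (barycenter (continuous_extIncl (K := K))) where
  toIsAffineExtension := isAffineExtension_barycenter _ extIncl_smul
    fun k hk => ⟨K.toExtFlow k (subset_closure hk), rfl⟩
  eq_of_meets C hC h := by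
    refine hC.eq_carrier_of_diracProb_mem fun x => ?_
    obtain ⟨Λ, hΛC, hΛ⟩ := h (K.extIncl x) (extIncl_mem x)
    have : Λ ∈ convexHull ℝ {(diracProb K.extFlow x : (probFlow K.extFlow).E)} := by
      refine convexHull_mono ?_ hΛ
      rintro _ ⟨Θ, ⟨hΘ, hΘx⟩, rfl⟩
      obtain ⟨y, rfl⟩ := mem_extClosure_probFlow.1 hΘ
      rw [barycenter_dirac] at hΘx
      rw [extIncl_injective hΘx]
      rfl
    rw [convexHull_singleton] at this
    rwa [← show Λ = _ from this]

/-- Let `W` be a flow over `L` that embeds into the fiber product of two proximally irreducible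
extensions `K` and `K'` and none of whose proper subflows maps onto the closure of the set of
extreme points of `L`. Then `P(W)` is a proximally irreducible extension of `K`. -/
theorem isProxIrrExtension_barycenter_of_minimal {K K' L : AffineFlow G} {φ : K → L} {ψ : K' → L}
    (hφ : IsProxIrrExtension φ) (hψ : IsProxIrrExtension ψ) {W : GFlow G} {p : W → K} {q : W → K'}
    (hp : Continuous p) (hq : Continuous q) (hpg : ∀ (g : G) (w : W), p (g • w) = g • p w)
    (hqg : ∀ (g : G) (w : W), q (g • w) = g • q w)
    (hpe : ∀ w, (p w : K.E) ∈ K.extClosure) (hqe : ∀ w, (q w : K'.E) ∈ K'.extClosure)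
    (hpq : ∀ w, φ (p w) = ψ (q w)) (hinj : ∀ w w', p w = p w' → q w = q w' → w = w')
    (hsurj : ∀ y : L, (y : L.E) ∈ L.extClosure → ∃ w, φ (p w) = y)
    (hmin : ∀ T : Set W, IsClosed T → (∀ (g : G) (w : W), w ∈ T → g • w ∈ T) →
      (∀ y : L, (y : L.E) ∈ L.extClosure → ∃ w ∈ T, φ (p w) = y) → T = univ) :
    IsProxIrrExtension (barycenter hp) := by
  have hpr : ∀ x : K, (x : K.E) ∈ K.extClosure → x ∈ range p := fun x hx =>
    hφ.mem_of_surjOn (isCompact_range hp).isClosed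
      (by rintro g _ ⟨w, rfl⟩; exact ⟨g • w, hpg g w⟩)
      (fun y hy => by
        obtain ⟨w, hw⟩ := hsurj y hy
        exact ⟨p w, ⟨w, rfl⟩, hpe w, hw⟩) hx
  refine ⟨isAffineExtension_barycenter hp hpg fun k hk => hpr k (subset_closure hk), ?_⟩
  intro C hC h
  let p' : W → K.extFlow := fun w => K.toExtFlow (p w) (hpe w)
  have hp' : Continuous p' := continuous_extFlow_iff.2 hp
  have hA : Continuous fun w => diracProb K.extFlow (p' w) := continuous_diracProb.comp hp'
  have hAg : ∀ (g : G) (w : W), diracProb K.extFlow (p' (g • w)) =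
      g • diracProb K.extFlow (p' w) := fun g w => by
    rw [← diracProb_smul]
    exact congrArg _ (extIncl_injective (hpg g w))
  have hAa := preservesConvexComb_barycenter hA
  have hqa := preservesConvexComb_barycenter hq
  have hTc : IsClosed ({Λ : probFlow W | (Λ : (probFlow W).E) ∈ C} ∩
      barycenter hA ⁻¹' range (diracProb K.extFlow)) :=
    hC.isClosed_preimage.inter (isClosed_range_diracProb.preimage (continuous_barycenter hA))
  -- The members of `C` whose image on `K.extFlow` is a Dirac measure still have barycenters filling
  -- `extClosure K'`: those in the hull over `x` land in the hull of the fiber of `ψ` over `φ x`.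
  have key : ∀ z : K', (z : K'.E) ∈ K'.extClosure → z ∈ barycenter hq ''
      ({Λ : probFlow W | (Λ : (probFlow W).E) ∈ C} ∩
        barycenter hA ⁻¹' range (diracProb K.extFlow)) := fun z hz => by
    refine hψ.mem_of_meets (hTc.isCompact.image (continuous_barycenter hq)).isClosed ?_ ?_ hz
    · rintro g _ ⟨Λ, ⟨hΛ, x, hx⟩, rfl⟩
      refine ⟨g • Λ, ⟨hC.smul_mem g Λ hΛ, (g • x : K.extFlow), ?_⟩, barycenter_smul hq hqg g Λ⟩
      rw [barycenter_smul hA hAg, diracProb_smul, hx]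
    · intro y hy
      obtain ⟨x, hx, rfl⟩ := hφ.exists_mem_extClosure hy
      obtain ⟨Λ₀, hΛC, hΛ⟩ := h x hx
      lift Λ₀ to probFlow W using hC.subset hΛC with Λ
      refine ⟨_, ⟨Λ, ⟨hΛC, K.toExtFlow x hx, ?_⟩, rfl⟩, ?_⟩
      · have h1 := hAa.map_mem_convexHull (probFlow W).convex hΛ
        have h2 : Subtype.val '' (barycenter hA '' {Λ : probFlow W |
            (Λ : (probFlow W).E) ∈ (probFlow W).extClosure ∧ barycenter hp Λ = x}) ⊆
            {(diracProb K.extFlow (K.toExtFlow x hx) : (probFlow K.extFlow).E)} := by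
          rintro _ ⟨_, ⟨Θ, ⟨hΘ, hΘx⟩, rfl⟩, rfl⟩
          obtain ⟨w, rfl⟩ := mem_extClosure_probFlow.1 hΘ
          rw [barycenter_dirac] at hΘx
          rw [barycenter_dirac]
          exact congrArg (fun v => (diracProb K.extFlow v).1) (extIncl_injective hΘx)
        have h3 := convexHull_mono h2 h1
        rw [convexHull_singleton] at h3
        exact (Subtype.ext h3).symm
      · refine convexHull_mono ?_ (hqa.map_mem_convexHull (probFlow W).convex hΛ)
        rintro _ ⟨_, ⟨Θ, ⟨hΘ, hΘx⟩, rfl⟩, rfl⟩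
        obtain ⟨w, rfl⟩ := mem_extClosure_probFlow.1 hΘ
        rw [barycenter_dirac] at hΘx
        rw [barycenter_dirac]
        exact ⟨q w, ⟨hqe w, by rw [← hpq, hΘx]⟩, rfl⟩
  set W' : Set W := {w | (diracProb W w : (probFlow W).E) ∈ C} with hW'
  have hWc : IsClosed W' := hC.isClosed_preimage.preimage continuous_diracProb
  have hWe : ∀ z : K', (z : K'.E) ∈ K'.extClosure → z ∈ q '' W' := fun z hz => by
    refine mem_of_mem_extClosure (hWc.isCompact.image hq).isClosed (fun z hz => ?_) hz
    obtain ⟨Λ, ⟨hΛC, x, hx⟩, hΛz⟩ := key z (subset_closure hz)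
    -- Both `z` and the Dirac measure at `x` are extreme, so `Λ` lies in an intersection of two
    -- closed faces. A Dirac measure there determines both coordinates of its point of `W`, so `Λ`
    -- is that Dirac measure.
    have e1 := hqa.isExtreme_preimage (y := z) hz
    have e2 := hAa.isExtreme_preimage (diracProb_mem_extremePoints x)
    have v1 := (hqa.convex_fiber (probFlow W).convex z).inter
      (hAa.convex_fiber (probFlow W).convex (diracProb K.extFlow x))
    have e3 := e1.inter e2
    rw [← image_inter Subtype.val_injective] at v1 e3
    have hu : ∀ w, diracProb W w ∈ barycenter hq ⁻¹' {z} ∩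
        barycenter hA ⁻¹' {diracProb K.extFlow x} → q w = z ∧ p w = K.extIncl x := by
      rintro w ⟨h1, h2⟩
      rw [mem_preimage, barycenter_dirac] at h1 h2
      exact ⟨h1, congrArg K.extIncl (diracProb_injective h2)⟩
    have hΛB : Λ ∈ barycenter hq ⁻¹' {z} ∩ barycenter hA ⁻¹' {diracProb K.extFlow x} :=
      ⟨hΛz, hx.symm⟩
    obtain ⟨w, rfl⟩ := exists_diracProb_mem_face
      ((isClosed_singleton.preimage (continuous_barycenter hq)).inter
        (isClosed_singleton.preimage (continuous_barycenter hA))) e3 v1 hΛB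
      fun w w' hw hw' => hinj w w' ((hu w hw).2.trans (hu w' hw').2.symm)
        ((hu w hw).1.trans (hu w' hw').1.symm)
    exact ⟨w, hΛC, (hu w hΛB).1⟩
  have hWu : W' = univ := by
    refine hmin W' hWc (fun g w hw => ?_) fun y hy => ?_
    · change (diracProb W (g • w) : (probFlow W).E) ∈ C
      rw [diracProb_smul]
      exact hC.smul_mem g _ hw
    · obtain ⟨z, hz, rfl⟩ := hψ.exists_mem_extClosure hy
      obtain ⟨w, hw, rfl⟩ := hWe z hz
      exact ⟨w, hw, hpq w⟩
  exact hC.eq_carrier_of_diracProb_mem fun w => (hWu ▸ mem_univ w : w ∈ W')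

end AffineFlow

/-! ### Dense orbits: compositions stay proximally irreducible. -/

namespace AffineFlow

variable {G : Type u} [Group G] [TopologicalSpace G]

/-- The limit of the translates `g • x` along an ultrafilter on the group. It is affine in `x`, but
not continuous. -/
noncomputable def ulim {K : AffineFlow G} (𝒰 : Ultrafilter G) (x : K) : K :=
  Ultrafilter.extend (fun g => g • x) 𝒰

section

variable {K L : AffineFlow G} (𝒰 : Ultrafilter G)

theorem tendsto_ulim (x : K) : Filter.Tendsto (fun g : G => g • x) 𝒰 (𝓝 (ulim 𝒰 x)) :=
  (ultrafilter_extend_eq_iff (f := fun g : G => g • x) (b := 𝒰)).1 rfl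

theorem preservesConvexComb_ulim : PreservesConvexComb (ulim (K := K) 𝒰) := by
  intro x y z a b ha hb hab h
  have hc := continuous_subtype_val (p := fun x => x ∈ K.carrier)
  have hz := (hc.tendsto _).comp (tendsto_ulim 𝒰 z)
  have hxy := (((hc.tendsto _).comp (tendsto_ulim 𝒰 x)).const_smul a).add
    (((hc.tendsto _).comp (tendsto_ulim 𝒰 y)).const_smul b)
  exact tendsto_nhds_unique hz (hxy.congr fun g => (K.affine g x y z a b ha hb hab h).symm)

theorem map_ulim {φ : K → L} (hc : Continuous φ) (hg : ∀ (g : G) (x : K), φ (g • x) = g • φ x)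
    (x : K) : φ (ulim 𝒰 x) = ulim 𝒰 (φ x) :=
  tendsto_nhds_unique ((hc.tendsto _).comp (tendsto_ulim 𝒰 x))
    ((tendsto_ulim 𝒰 (φ x)).congr fun g => (hg g x).symm)

theorem ulim_mem {D : Set K} (hD : IsClosed D) {x : K} (h : ∀ g : G, g • x ∈ D) :
    ulim 𝒰 x ∈ D :=
  hD.mem_of_tendsto (tendsto_ulim 𝒰 x) (Filter.Eventually.of_forall h)

theorem exists_ulim_eq {x z : K} (h : z ∈ closure (range fun g : G => g • x)) :
    ∃ 𝒰 : Ultrafilter G, ulim 𝒰 x = z := by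
  have hne : (Filter.comap (fun g : G => g • x) (𝓝 z)).NeBot := by
    rw [Filter.comap_neBot_iff]
    intro U hU
    obtain ⟨_, hz, g, rfl⟩ := mem_closure_iff_nhds.1 h U hU
    exact ⟨g, hz⟩
  refine ⟨Ultrafilter.of (Filter.comap (fun g : G => g • x) (𝓝 z)), ?_⟩
  exact tendsto_nhds_unique (tendsto_ulim _ x)
    (Filter.tendsto_comap.mono_left (Ultrafilter.of_le _))

/-- Finite convex combinations pass through the affine map `ulim` without any continuity in the
point; the unclosed hull in the definition is what makes this available. -/
theorem ulim_mem_convexHull_fiber {φ : K → L} (hc : Continuous φ)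
    (hg : ∀ (g : G) (x : K), φ (g • x) = g • φ x) {x : K} {y : L}
    (hx : (x : K.E) ∈
      convexHull ℝ (Subtype.val '' {x : K | (x : K.E) ∈ K.extClosure ∧ φ x = y})) :
    (ulim 𝒰 x : K.E) ∈
      convexHull ℝ (Subtype.val '' {x : K | (x : K.E) ∈ K.extClosure ∧ φ x = ulim 𝒰 y}) := by
  refine convexHull_mono ?_ ((preservesConvexComb_ulim 𝒰).map_mem_convexHull K.convex hx)
  rintro _ ⟨_, ⟨z, ⟨hz, rfl⟩, rfl⟩, rfl⟩
  exact ⟨_, ⟨ulim_mem 𝒰 K.isClosed_mem_extClosure fun g => smul_mem_extClosure g hz,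
    map_ulim 𝒰 hc hg z⟩, rfl⟩

end

theorem smul_mem_closure_orbit {K : AffineFlow G} {x z : K}
    (hz : z ∈ closure (range fun g : G => g • x)) (g : G) :
    g • z ∈ closure (range fun g : G => g • x) :=
  map_mem_closure (continuous_const_smul g) hz (by
    rintro _ ⟨h, rfl⟩
    exact ⟨g * h, mul_smul g h x⟩)

/-- If the orbit of some extreme point is dense in the closure of the set of extreme points, then
compositions of proximally irreducible extensions are proximally irreducible. -/
theorem composesProxIrr_of_dense_orbit {L : AffineFlow G} {y₀ : L}
    (hy₀ : (y₀ : L.E) ∈ L.carrier.extremePoints ℝ)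
    (hd : ∀ y : L, (y : L.E) ∈ L.extClosure → y ∈ closure (range fun g : G => g • y₀)) :
    L.ComposesProxIrr := by
  intro K P φ ψ hφ hψ
  refine ⟨hφ.comp hψ.toIsAffineExtension, fun D hD h =>
    hψ.eq_of_meets D hD fun x hx => ?_⟩
  have hDc := hD.isClosed_preimage
  obtain ⟨x₀, hx₀, hxy⟩ := hφ.exists_extremePoint hy₀
  -- The extreme point `x₀` over `y₀` inherits a dense orbit: limits of its translates reach every
  -- fiber.
  have hKd : ∀ x : K, (x : K.E) ∈ K.extClosure → x ∈ closure (range fun g : G => g • x₀) := by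
    refine fun x hx => hφ.mem_of_surjOn isClosed_closure
      (fun g x hx => smul_mem_closure_orbit hx g) (fun y hy => ?_) hx
    obtain ⟨𝒰, rfl⟩ := exists_ulim_eq (hd y hy)
    exact ⟨ulim 𝒰 x₀, ulim_mem 𝒰 isClosed_closure fun g => subset_closure ⟨g, rfl⟩,
      ulim_mem 𝒰 K.isClosed_mem_extClosure fun g =>
        smul_mem_extClosure g (subset_closure hx₀),
      by rw [map_ulim 𝒰 hφ.continuous hφ.map_smul, hxy]⟩
  obtain ⟨μ, hμD, hμ⟩ := h y₀ (subset_closure hy₀)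
  lift μ to P using hD.subset hμD
  have hψμ : (ψ μ : K.E) ∈
      convexHull ℝ (Subtype.val '' {x : K | (x : K.E) ∈ K.extClosure ∧ φ x = y₀}) := by
    refine convexHull_mono ?_ (hψ.affine.map_mem_convexHull P.convex hμ)
    rintro _ ⟨_, ⟨w, ⟨hw, hwy⟩, rfl⟩, rfl⟩
    exact ⟨_, ⟨hψ.map_mem_extClosure hw, hwy⟩, rfl⟩
  -- The orbit closure of `ψ μ` meets the hull over every `y`, being moved there from `y₀`;
  -- irreducibility of `φ` puts `x₀` in it.
  have hx₀μ : x₀ ∈ closure (range fun g : G => g • ψ μ) := by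
    refine hφ.mem_of_meets isClosed_closure (fun g x hx => smul_mem_closure_orbit hx g)
      (fun y hy => ?_) (subset_closure hx₀)
    obtain ⟨𝒰, rfl⟩ := exists_ulim_eq (hd y hy)
    exact ⟨ulim 𝒰 (ψ μ), ulim_mem 𝒰 isClosed_closure fun g => subset_closure ⟨g, rfl⟩,
      ulim_mem_convexHull_fiber 𝒰 hφ.continuous hφ.map_smul hψμ⟩
  obtain ⟨𝒰, h𝒰⟩ := exists_ulim_eq hx₀μ
  rw [← map_ulim 𝒰 hψ.continuous hψ.map_smul] at h𝒰
  have hνD : (ulim 𝒰 μ : P.E) ∈ D := ulim_mem 𝒰 hDc fun g => hD.smul_mem g μ hμD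
  have hν := ulim_mem_convexHull_fiber 𝒰 (hφ.continuous.comp hψ.continuous)
    (fun g x => by simp [hψ.map_smul, hφ.map_smul]) hμ
  -- The limit of translates of `μ` maps exactly to `x₀`. Since `x₀` is extreme, this limit is a
  -- combination of points of the fiber of `ψ` over `x₀`, and can be moved on to any `x`.
  have hν' := hψ.affine.mem_convexHull_fiber P.convex hν (by rw [h𝒰]; exact hx₀)
  obtain ⟨𝒱, rfl⟩ := exists_ulim_eq (hKd x hx)
  refine ⟨ulim 𝒱 (ulim 𝒰 μ), ulim_mem 𝒱 hDc fun g => hD.smul_mem g _ hνD,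
    ulim_mem_convexHull_fiber 𝒱 hψ.continuous hψ.map_smul (convexHull_mono ?_ hν')⟩
  rintro _ ⟨w, ⟨hw, hwx⟩, rfl⟩
  exact ⟨w, ⟨hw.1, hwx.trans h𝒰⟩, rfl⟩

theorem composesProxIrr_probFlow {Y : GFlow G} {y₀ : Y} (h : Dense (MulAction.orbit G y₀)) :
    (probFlow Y).ComposesProxIrr := by
  refine composesProxIrr_of_dense_orbit (diracProb_mem_extremePoints y₀) fun Λ hΛ => ?_
  obtain ⟨y, rfl⟩ := mem_extClosure_probFlow.1 hΛ
  refine map_mem_closure continuous_diracProb (h y) ?_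
  rintro _ ⟨g, rfl⟩
  exact ⟨g, (diracProb_smul g y₀).symm⟩

theorem composesProxIrr_probFlow_of_isEmpty {Y : GFlow G} (h : IsEmpty Y) :
    (probFlow Y).ComposesProxIrr := by
  intro K P φ ψ hφ hψ
  refine ⟨hφ.comp hψ.toIsAffineExtension, fun D hD _ => ?_⟩
  obtain ⟨x, hx⟩ := hD.nonempty
  obtain ⟨z, hz⟩ := (probFlow Y).isCompact.extremePoints_nonempty ⟨_, (φ (ψ ⟨x, hD.subset hx⟩)).2⟩
  obtain ⟨y, -⟩ := mem_range_diracProb_of_mem_extremePoints (Λ := ⟨z, hz.1⟩) hz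
  exact h.elim y

end AffineFlow

/-! ### Minimal closed invariant sets over a base. -/

section Minimal

variable {G : Type u} [Group G] [TopologicalSpace G]

/-- A closed invariant set that maps onto `S` contains a closed invariant set, here given as a
flow `W`, which is minimal among those that map onto `S`. -/
theorem GFlow.exists_minimal {V : GFlow G} {Y : Type*} [TopologicalSpace Y] [T2Space Y] {π : V → Y}
    (hπ : Continuous π) {S : Set Y} {R : Set V} (hR : IsClosed R)
    (hRinv : ∀ (g : G) (v : V), v ∈ R → g • v ∈ R) (hS : ∀ y ∈ S, ∃ v ∈ R, π v = y) :
    ∃ (W : GFlow G) (i : W → V), Continuous i ∧ (∀ (g : G) (w : W), i (g • w) = g • i w) ∧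
      Function.Injective i ∧ (∀ w, i w ∈ R) ∧ (∀ y ∈ S, ∃ w, π (i w) = y) ∧
      ∀ T : Set W, IsClosed T → (∀ (g : G) (w : W), w ∈ T → g • w ∈ T) →
        (∀ y ∈ S, ∃ w ∈ T, π (i w) = y) → T = univ := by
  let A : Set (Set V) := {T | IsClosed T ∧ (∀ (g : G) (v : V), v ∈ T → g • v ∈ T) ∧
    ∀ y ∈ S, ∃ v ∈ T, π v = y}
  obtain ⟨T, hTR, hT⟩ : ∃ T, T ⊆ R ∧ Minimal (· ∈ A) T := by
    refine zorn_superset_nonempty A (fun F hF hFc hne => ?_) R ⟨hR, hRinv, hS⟩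
    refine ⟨⋂₀ F, ⟨isClosed_sInter fun T hT => (hF hT).1,
      fun g v hv T hT => (hF hT).2.1 g v (hv T hT), fun y hy => ?_⟩,
      fun T hT => sInter_subset_of_mem hT⟩
    have : Nonempty F := hne.to_subtype
    have hc : ∀ T : F, IsClosed (T.1 ∩ π ⁻¹' {y}) := fun T =>
      (hF T.2).1.inter (isClosed_singleton.preimage hπ)
    obtain ⟨v, hv⟩ := IsCompact.nonempty_iInter_of_directed_nonempty_isCompact_isClosed
      (fun T : F => T.1 ∩ π ⁻¹' {y}) (fun T U => by
        rcases hFc.total T.2 U.2 with h | h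
        · exact ⟨T, Subset.rfl, inter_subset_inter_left _ h⟩
        · exact ⟨U, inter_subset_inter_left _ h, Subset.rfl⟩)
      (fun T => (hF T.2).2.2 y hy) (fun T => (hc T).isCompact) hc
    rw [mem_iInter] at hv
    exact ⟨v, fun T hT => (hv ⟨T, hT⟩).1, (hv (Classical.arbitrary F)).2⟩
  refine ⟨V.sub T hT.prop.1 hT.prop.2.1, Subtype.val, continuous_subtype_val, fun g w => rfl,
    Subtype.val_injective, fun w => hTR w.2, fun y hy => ?_, fun U hU hUinv hUS => ?_⟩
  · obtain ⟨v, hv, hvy⟩ := hT.prop.2.2 y hy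
    exact ⟨⟨v, hv⟩, hvy⟩
  · have hU' : Subtype.val '' U ∈ A := by
      refine ⟨(hU.isCompact.image continuous_subtype_val).isClosed, ?_, fun y hy => ?_⟩
      · rintro g _ ⟨w, hw, rfl⟩
        exact ⟨_, hUinv g w hw, rfl⟩
      · obtain ⟨w, hw, hwy⟩ := hUS y hy
        exact ⟨_, ⟨w, hw, rfl⟩, hwy⟩
    have hsub : T ⊆ Subtype.val '' U :=
      hT.le_of_le hU' (by rintro _ ⟨w, -, rfl⟩; exact w.2)
    refine eq_univ_of_forall fun w => ?_
    obtain ⟨w', hw', h⟩ := hsub w.2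
    rwa [← Subtype.ext h]

end Minimal

/-! ### Uniqueness of the maximal extension. -/

namespace AffineFlow

variable {G : Type u} [Group G] [TopologicalSpace G]

theorem IsAffineIso.exists_inverse {K L : AffineFlow G} {φ : K → L} (hφ : IsAffineIso φ) :
    ∃ θ : L → K, IsAffineIso θ ∧ φ ∘ θ = id := by
  let e := Equiv.ofBijective φ ⟨hφ.injective, hφ.surjective⟩
  have he : ∀ y, φ (e.symm y) = y := e.apply_symm_apply
  refine ⟨e.symm, ⟨⟨?_, ?_, ?_, e.symm.surjective⟩, e.symm.injective⟩, funext he⟩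
  · exact Continuous.continuous_symm_of_equiv_compact_to_t2 (f := e) hφ.continuous
  · intro g y
    apply hφ.injective
    rw [he, hφ.map_smul, he]
  · intro x y z a b ha hb hab h
    have h1 := hφ.affine (e.symm x) (e.symm y)
      ⟨_, K.convex (e.symm x).2 (e.symm y).2 ha hb hab⟩ a b ha hb hab rfl
    rw [he, he, ← h] at h1
    have h2 := congrArg e.symm (Subtype.ext h1)
    rw [← h2]
    exact congrArg Subtype.val (e.symm_apply_apply _)

theorem IsAffineIso.comp {K L P : AffineFlow G} {φ : K → L} {ψ : P → K} (hφ : IsAffineIso φ)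
    (hψ : IsAffineIso ψ) : IsAffineIso (φ ∘ ψ) :=
  ⟨hφ.toIsAffineExtension.comp hψ.toIsAffineExtension, hφ.injective.comp hψ.injective⟩

/-- Affine isomorphisms preserve extreme points. -/
theorem IsAffineIso.map_mem_extremePoints {K L : AffineFlow G} {φ : K → L} (hφ : IsAffineIso φ)
    {x : K} (hx : (x : K.E) ∈ K.carrier.extremePoints ℝ) :
    ((φ x : L) : L.E) ∈ L.carrier.extremePoints ℝ := by
  obtain ⟨θ, hθ, hφθ⟩ := hφ.exists_inverse
  have h := hθ.affine.isExtreme_preimage (y := x) hx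
  have h2 : θ ⁻¹' {x} = {φ x} := by
    ext z
    have hz : φ (θ z) = z := congrFun hφθ z
    simp only [mem_preimage, mem_singleton_iff]
    exact ⟨fun h => by rw [← h, hz], fun h => hφ.injective (by rw [hz, h])⟩
  rwa [h2, image_singleton, isExtreme_singleton] at h

/-- The main lemma, applied both ways round to a minimal `W`, gives proximally irreducible maps from
`P(W)` to `K` and `K'`; maximality makes them isomorphisms. -/
theorem IsMaxProxIrrExtension.exists_iso {L K K' : AffineFlow G} {φ : K → L} {ψ : K' → L}
    (hφ : IsMaxProxIrrExtension φ) (hψ : IsMaxProxIrrExtension ψ) :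
    ∃ η : K → K', IsAffineIso η ∧ ψ ∘ η = φ := by
  obtain ⟨hφ, hK⟩ := hφ
  obtain ⟨hψ, hK'⟩ := hψ
  let V := GFlow.prod K.extFlow K'.extFlow
  let p₀ : V → K := fun v => K.extIncl v.1
  let q₀ : V → K' := fun v => K'.extIncl v.2
  have hp₀ : Continuous p₀ := continuous_extIncl.comp continuous_fst
  have hq₀ : Continuous q₀ := continuous_extIncl.comp continuous_snd
  obtain ⟨W, i, hi, hig, hinj, hR, hsurj, hmin⟩ := GFlow.exists_minimal (V := V) (π := φ ∘ p₀)
    (hφ.continuous.comp hp₀) (S := {y : L | (y : L.E) ∈ L.extClosure})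
    (R := {v | φ (p₀ v) = ψ (q₀ v)})
    (isClosed_eq (hφ.continuous.comp hp₀) (hψ.continuous.comp hq₀))
    (fun g v hv => by
      change φ (g • p₀ v) = ψ (g • q₀ v)
      rw [hφ.map_smul, hψ.map_smul, show φ (p₀ v) = ψ (q₀ v) from hv])
    (fun y hy => by
      obtain ⟨x, hx, hxy⟩ := hφ.exists_mem_extClosure hy
      obtain ⟨z, hz, hzy⟩ := hψ.exists_mem_extClosure hy
      exact ⟨(K.toExtFlow x hx, K'.toExtFlow z hz), hxy.trans hzy.symm, hxy⟩)
  have hpq : ∀ w, φ (p₀ (i w)) = ψ (q₀ (i w)) := hR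
  have hp : Continuous (p₀ ∘ i) := hp₀.comp hi
  have hq : Continuous (q₀ ∘ i) := hq₀.comp hi
  have hpg : ∀ (g : G) (w : W), (p₀ ∘ i) (g • w) = g • (p₀ ∘ i) w := fun g w => by
    simp only [Function.comp_apply, hig]; rfl
  have hqg : ∀ (g : G) (w : W), (q₀ ∘ i) (g • w) = g • (q₀ ∘ i) w := fun g w => by
    simp only [Function.comp_apply, hig]; rfl
  have hα := isProxIrrExtension_barycenter_of_minimal hφ hψ hp hq hpg hqg
    (fun w => extIncl_mem _) (fun w => extIncl_mem _) hpq
    (fun w w' h1 h2 => hinj (Prod.ext (extIncl_injective h1) (extIncl_injective h2)))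
    hsurj hmin
  have hα' := isProxIrrExtension_barycenter_of_minimal hψ hφ hq hp hqg hpg
    (fun w => extIncl_mem _) (fun w => extIncl_mem _) (fun w => (hpq w).symm)
    (fun w w' h1 h2 => hinj (Prod.ext (extIncl_injective h2) (extIncl_injective h1)))
    (fun y hy => by
      obtain ⟨w, hw⟩ := hsurj y hy
      exact ⟨w, (hpq w).symm.trans hw⟩)
    (fun T hT hTg h => hmin T hT hTg fun y hy => by
      obtain ⟨w, hw, hwy⟩ := h y hy
      exact ⟨w, hw, (hpq w).trans hwy⟩)
  have e := hK _ _ hα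
  have e' := hK' _ _ hα'
  obtain ⟨θ, hθ, hαθ⟩ := e.exists_inverse
  refine ⟨_, e'.comp hθ, ?_⟩
  have hcomm : φ ∘ barycenter hp = ψ ∘ barycenter hq :=
    probFlow_map_ext (hφ.continuous.comp hα.continuous) (hψ.continuous.comp hα'.continuous)
      (hφ.toIsAffineExtension.comp hα.toIsAffineExtension).affine
      (hψ.toIsAffineExtension.comp hα'.toIsAffineExtension).affine fun w => by
        simp only [Function.comp_apply, barycenter_dirac]
        exact hpq w
  rw [← Function.comp_assoc, ← hcomm, Function.comp_assoc, hαθ, Function.comp_id]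

/-- The flow is recovered from `P(X)` as the set of extreme points, which are the Dirac measures. -/
theorem exists_homeomorph_of_isAffineIso {X Z : GFlow G} {η : probFlow X → probFlow Z}
    (hη : IsAffineIso η) : ∃ e : X ≃ₜ Z, ∀ (g : G) (x : X), e (g • x) = g • e x := by
  have h : ∀ x, ∃ z, diracProb Z z = η (diracProb X x) := fun x =>
    mem_range_diracProb_of_mem_extremePoints
      (hη.map_mem_extremePoints (diracProb_mem_extremePoints x))
  choose e he using h
  have hemb : IsClosedEmbedding (diracProb Z) :=
    continuous_diracProb.isClosedEmbedding diracProb_injective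
  have hec : Continuous e := by
    rw [hemb.continuous_iff, show diracProb Z ∘ e = η ∘ diracProb X from funext he]
    exact hη.continuous.comp continuous_diracProb
  have hinj : Function.Injective e := fun x y hxy =>
    diracProb_injective (hη.injective (by rw [← he, ← he, hxy]))
  have hsurj : Function.Surjective e := by
    intro z
    obtain ⟨Λ, hΛ, hΛz⟩ := hη.exists_extremePoint (diracProb_mem_extremePoints z)
    obtain ⟨x, rfl⟩ := mem_range_diracProb_of_mem_extremePoints hΛ
    exact ⟨x, diracProb_injective ((he x).trans hΛz)⟩
  refine ⟨Continuous.homeoOfEquivCompactToT2 (f := Equiv.ofBijective e ⟨hinj, hsurj⟩) hec,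
    fun g x => diracProb_injective ?_⟩
  change diracProb Z (e (g • x)) = diracProb Z (g • e x)
  rw [he, diracProb_smul, hη.map_smul, diracProb_smul, he]

end AffineFlow

/-! ### Image flows, and rigidity of maps from a minimal flow. -/

namespace GFlow

variable {G : Type u} [Group G] [TopologicalSpace G]

/-- The image of a flow under a continuous equivariant map, as a flow. -/
theorem exists_image {W V : GFlow G} {m : W → V} (hm : Continuous m)
    (hmg : ∀ (g : G) (w : W), m (g • w) = g • m w) :
    ∃ (V' : GFlow G) (r : W → V') (j : V' → V), Continuous r ∧ Continuous j ∧
      (∀ (g : G) (w : W), r (g • w) = g • r w) ∧ (∀ (g : G) (v : V'), j (g • v) = g • j v) ∧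
      Function.Surjective r ∧ Function.Injective j ∧ ∀ w, j (r w) = m w :=
  ⟨V.sub (range m) (isCompact_range hm).isClosed (by rintro g _ ⟨w, rfl⟩; exact ⟨g • w, hmg g w⟩),
    fun w => ⟨m w, w, rfl⟩, Subtype.val, hm.subtype_mk _, continuous_subtype_val,
    fun g w => Subtype.ext (hmg g w), fun _ _ => rfl, fun ⟨_, w, hw⟩ => ⟨w, Subtype.ext hw⟩,
    Subtype.val_injective, fun _ => rfl⟩

end GFlow

namespace AffineFlow

variable {G : Type u} [Group G] [TopologicalSpace G]

/-- Two maps over `L` from a minimal flow over `L` to a proximally irreducible extension agree. -/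
theorem IsProxIrrExtension.eq_of_minimal {K L : AffineFlow G} {φ : K → L}
    (hφ : IsProxIrrExtension φ) {W : GFlow G} {a b : W → K} (ha : Continuous a) (hb : Continuous b)
    (hag : ∀ (g : G) (w : W), a (g • w) = g • a w) (hbg : ∀ (g : G) (w : W), b (g • w) = g • b w)
    (hae : ∀ w, (a w : K.E) ∈ K.extClosure) (hbe : ∀ w, (b w : K.E) ∈ K.extClosure)
    (hab : ∀ w, φ (a w) = φ (b w))
    (hsurj : ∀ y : L, (y : L.E) ∈ L.extClosure → ∃ w, φ (a w) = y)
    (hmin : ∀ T : Set W, IsClosed T → (∀ (g : G) (w : W), w ∈ T → g • w ∈ T) →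
      (∀ y : L, (y : L.E) ∈ L.extClosure → ∃ w ∈ T, φ (a w) = y) → T = univ) : a = b := by
  have h2 : (0 : ℝ) ≤ 2⁻¹ := by norm_num
  have h2' : (2⁻¹ : ℝ) + 2⁻¹ = 1 := by norm_num
  -- Midpoints of `a w` and `b w` lie in the hull of the fiber, so the range of `m` contains all
  -- extreme points; an extreme midpoint forces `a w = b w`. The equalizer is thus large enough for
  -- minimality.
  let m : W → K := fun w =>
    ⟨(2⁻¹ : ℝ) • (a w : K.E) + (2⁻¹ : ℝ) • (b w : K.E), K.convex (a w).2 (b w).2 h2 h2 h2'⟩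
  have hm : Continuous m := Continuous.subtype_mk
    (((continuous_subtype_val.comp ha).const_smul _).add
      ((continuous_subtype_val.comp hb).const_smul _)) _
  have hmg : ∀ (g : G) (w : W), m (g • w) = g • m w := fun g w => by
    refine Subtype.ext ?_
    have := K.affine g (a w) (b w) (m w) _ _ h2 h2 h2' rfl
    change (m (g • w) : K.E) = ((fun x : K => g • x) (m w) : K.E)
    rw [this]
    simp only [← hag, ← hbg]
    rfl
  have hmr : ∀ x : K, (x : K.E) ∈ K.extClosure → x ∈ range m := fun x hx => by
    refine hφ.mem_of_meets (isCompact_range hm).isClosed ?_ (fun y hy => ?_) hx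
    · rintro g _ ⟨w, rfl⟩
      exact ⟨g • w, hmg g w⟩
    · obtain ⟨w, rfl⟩ := hsurj y hy
      have hmem : ∀ x : K, (x : K.E) ∈ K.extClosure → φ x = φ (a w) → (x : K.E) ∈ convexHull ℝ
          (Subtype.val '' {x : K | (x : K.E) ∈ K.extClosure ∧ φ x = φ (a w)}) :=
        fun x hx hxw => subset_convexHull ℝ _ ⟨x, ⟨hx, hxw⟩, rfl⟩
      exact ⟨m w, ⟨w, rfl⟩, convex_convexHull ℝ _ (hmem _ (hae w) rfl)
        (hmem _ (hbe w) (hab w).symm) h2 h2 h2'⟩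
  have hEc : IsClosed {w | a w = b w} := isClosed_eq ha hb
  have hEr : ∀ x : K, (x : K.E) ∈ K.extClosure → x ∈ a '' {w | a w = b w} := fun x hx => by
    refine mem_of_mem_extClosure (hEc.isCompact.image ha).isClosed (fun x hx => ?_) hx
    obtain ⟨w, rfl⟩ := hmr x (subset_closure hx)
    have h3 : (m w : K.E) ∈ openSegment ℝ (a w : K.E) (b w) :=
      ⟨2⁻¹, 2⁻¹, by norm_num, by norm_num, h2', rfl⟩
    have h4 := (mem_extremePoints.1 hx).2 _ (a w).2 _ (b w).2 h3
    exact ⟨w, Subtype.ext (h4.1.trans h4.2.symm), Subtype.ext h4.1⟩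
  have := hmin _ hEc (fun g w hw => by
    change a (g • w) = b (g • w)
    rw [hag, hbg, show a w = b w from hw]) fun y hy => by
      obtain ⟨x, hx, rfl⟩ := hφ.exists_mem_extClosure hy
      obtain ⟨w, hw, rfl⟩ := hEr x hx
      exact ⟨w, hw, rfl⟩
  exact funext fun w => (this ▸ mem_univ w : w ∈ {w | a w = b w})

/-! ### A set of extensions dominating all of them. -/

section Small

variable {L : AffineFlow G}

/-- The map onto the closure of the set of extreme points of an extension that is induced by a
choice of a point in every fiber. -/
noncomputable def selMap {Q : AffineFlow G} (sel : L.extFlow → Q.extFlow) :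
    Ultrafilter (G × L.extFlow) → Q.extFlow :=
  Ultrafilter.extend fun d => d.1 • sel d.2

theorem continuous_selMap {Q : AffineFlow G} (sel : L.extFlow → Q.extFlow) :
    Continuous (selMap sel) := continuous_ultrafilter_extend _

theorem selMap_pure {Q : AffineFlow G} (sel : L.extFlow → Q.extFlow) (d : G × L.extFlow) :
    selMap sel (pure d) = d.1 • sel d.2 := ultrafilter_extend_pure _ _

/-- The closure of the translates of the selected points is invariant and meets every fiber, so
irreducibility makes it all of `Q.extFlow`. This bounds the size of `Q.extFlow` in terms of `G` and
`L`. -/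
theorem surjective_selMap {Q : AffineFlow G} {θ : Q → L} (hθ : IsProxIrrExtension θ)
    {sel : L.extFlow → Q.extFlow} (hsel : ∀ y, θ (Q.extIncl (sel y)) = L.extIncl y) :
    Function.Surjective (selMap sel) := by
  intro x
  set T := closure (range fun d : G × L.extFlow => d.1 • sel d.2) with hT
  have h1 : T ⊆ range (selMap sel) :=
    closure_minimal (by rintro _ ⟨d, rfl⟩; exact ⟨pure d, selMap_pure sel d⟩)
      (isCompact_range (continuous_selMap sel)).isClosed
  have hTg : ∀ (g : G) (x : Q.extFlow), x ∈ T → g • x ∈ T := fun g x hx =>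
    map_mem_closure (continuous_const_smul g) hx (by
      rintro _ ⟨d, rfl⟩
      exact ⟨(g * d.1, d.2), mul_smul _ _ _⟩)
  have h2 : Q.extIncl x ∈ Q.extIncl '' T := by
    refine hθ.mem_of_surjOn (isClosed_closure.isCompact.image continuous_extIncl).isClosed ?_
      (fun y hy => ?_) (extIncl_mem x)
    · rintro g _ ⟨x, hx, rfl⟩
      exact ⟨g • x, hTg g x hx, rfl⟩
    · refine ⟨_, ⟨sel (L.toExtFlow y hy), subset_closure ⟨(1, L.toExtFlow y hy), one_smul _ _⟩, rfl⟩,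
        extIncl_mem _, hsel _⟩
  obtain ⟨x', hx', h⟩ := h2
  rw [← extIncl_injective h]
  exact h1 hx'

/-- Both extreme closures are quotients of the same ultrafilter space by the same relation.
Equivariance and compatibility with `L` are checked on principal ultrafilters, which are dense. -/
theorem exists_map_of_ker_selMap_eq {Q Q' : AffineFlow G} {θ : Q → L} {θ' : Q' → L}
    (hθ : IsProxIrrExtension θ) (hθ' : IsProxIrrExtension θ') {sel : L.extFlow → Q.extFlow}
    {sel' : L.extFlow → Q'.extFlow} (hsel : ∀ y, θ (Q.extIncl (sel y)) = L.extIncl y)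
    (hsel' : ∀ y, θ' (Q'.extIncl (sel' y)) = L.extIncl y)
    (hker : Setoid.ker (selMap sel) = Setoid.ker (selMap sel')) :
    ∃ a : Q.extFlow → Q'.extFlow, Continuous a ∧ (∀ (g : G) (x : Q.extFlow), a (g • x) = g • a x) ∧
      ∀ x, θ' (Q'.extIncl (a x)) = θ (Q.extIncl x) := by
  have hs := surjective_selMap hθ hsel
  have hq : IsQuotientMap (selMap sel) :=
    IsQuotientMap.of_surjective_continuous hs (continuous_selMap sel)
  let a : Q.extFlow → Q'.extFlow := fun x => selMap sel' (Function.surjInv hs x)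
  have ha : ∀ u, a (selMap sel u) = selMap sel' u := fun u => by
    have h1 : Setoid.ker (selMap sel) (Function.surjInv hs (selMap sel u)) u :=
      Function.surjInv_eq hs _
    rw [hker] at h1
    exact h1
  have hac : Continuous a := by
    rw [hq.continuous_iff, show a ∘ selMap sel = selMap sel' from funext ha]
    exact continuous_selMap sel'
  refine ⟨a, hac, fun g x => ?_, fun x => ?_⟩
  · obtain ⟨u, rfl⟩ := hs x
    refine congrFun (DenseRange.equalizer (g := fun u => a (g • selMap sel u))
      (h := fun u => g • a (selMap sel u)) denseRange_pure
      (hac.comp ((continuous_const_smul g).comp (continuous_selMap sel)))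
      ((continuous_const_smul g).comp (hac.comp (continuous_selMap sel))) (funext fun d => ?_)) u
    simp only [Function.comp_apply]
    rw [ha, selMap_pure, selMap_pure, ← mul_smul, ← mul_smul]
    exact (congrArg a (selMap_pure sel (g * d.1, d.2)).symm).trans
      ((ha _).trans (selMap_pure sel' (g * d.1, d.2)))
  · obtain ⟨u, rfl⟩ := hs x
    refine congrFun (DenseRange.equalizer (g := fun u => θ' (Q'.extIncl (a (selMap sel u))))
      (h := fun u => θ (Q.extIncl (selMap sel u))) denseRange_pure
      (hθ'.continuous.comp (continuous_extIncl.comp (hac.comp (continuous_selMap sel))))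
      (hθ.continuous.comp (continuous_extIncl.comp (continuous_selMap sel)))
      (funext fun d => ?_)) u
    simp only [Function.comp_apply]
    rw [ha, selMap_pure, selMap_pure, extIncl_smul, extIncl_smul, hθ'.map_smul, hθ.map_smul, hsel,
      hsel']

/-- There is a set of proximally irreducible extensions of `L` that dominates all of them. -/
theorem exists_dominating_family (L : AffineFlow G) :
    ∃ (I : Type u) (K : I → AffineFlow G) (φ : ∀ i, K i → L), (∀ i, IsProxIrrExtension (φ i)) ∧
      ∀ (Q : AffineFlow G) (θ : Q → L), IsProxIrrExtension θ →
        ∃ (i : I) (a : (K i).extFlow → Q.extFlow), Continuous a ∧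
          (∀ (g : G) (x : (K i).extFlow), a (g • x) = g • a x) ∧
          ∀ x, θ (Q.extIncl (a x)) = φ i ((K i).extIncl x) := by
  -- Extensions are indexed by the kernels they induce on one fixed type, which keeps the index set
  -- in `Type u`.
  let code : Setoid (Ultrafilter (G × L.extFlow)) → Prop := fun s =>
    ∃ (Q : AffineFlow G) (θ : Q → L) (sel : L.extFlow → Q.extFlow), IsProxIrrExtension θ ∧
      (∀ y, θ (Q.extIncl (sel y)) = L.extIncl y) ∧ Setoid.ker (selMap sel) = s
  have hI : ∀ s : {s // code s}, code s.1 := fun s => s.2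
  choose K φ sel hφ hsel hker using hI
  refine ⟨{s // code s}, K, φ, hφ, fun Q θ hθ => ?_⟩
  have h : ∀ y : L.extFlow, ∃ x : Q.extFlow, θ (Q.extIncl x) = L.extIncl y := fun y => by
    obtain ⟨x, hx, hxy⟩ := hθ.exists_mem_extClosure (extIncl_mem y)
    exact ⟨Q.toExtFlow x hx, hxy⟩
  choose sel' hsel' using h
  exact ⟨⟨_, Q, θ, sel', hθ, hsel', rfl⟩,
    exists_map_of_ker_selMap_eq (hφ _) hθ (hsel _) hsel' (hker _)⟩

end Small

/-! ### Fiber products of many extensions, and existence. -/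

section InverseLimit

variable {L : AffineFlow G} {I : Type u} {K : I → AffineFlow G} {φ : ∀ i, K i → L} {W : GFlow G}
  {p : ∀ i, W → (K i).extFlow} {y : W → L}

/-- Finitely many of the maps `p i` factor through a proximally irreducible extension. -/
theorem exists_proxIrr_factor (hL : L.ComposesProxIrr) (hφ : ∀ i, IsProxIrrExtension (φ i))
    (hp : ∀ i, Continuous (p i)) (hpg : ∀ i (g : G) (w : W), p i (g • w) = g • p i w)
    (hy : Continuous y) (hyg : ∀ (g : G) (w : W), y (g • w) = g • y w)
    (hye : ∀ w, (y w : L.E) ∈ L.extClosure) (hpy : ∀ i w, φ i ((K i).extIncl (p i w)) = y w)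
    (hsurj : ∀ z : L, (z : L.E) ∈ L.extClosure → ∃ w, y w = z)
    (hmin : ∀ T : Set W, IsClosed T → (∀ (g : G) (w : W), w ∈ T → g • w ∈ T) →
      (∀ z : L, (z : L.E) ∈ L.extClosure → ∃ w ∈ T, y w = z) → T = univ) (F : Finset I) :
    ∃ (V : GFlow G) (r : W → V) (ρ : V → L) (hρ : Continuous ρ), Continuous r ∧
      (∀ (g : G) (w : W), r (g • w) = g • r w) ∧ (∀ w, ρ (r w) = y w) ∧
      IsProxIrrExtension (barycenter hρ) ∧
      ∀ i ∈ F, ∃ s : V → (K i).extFlow, Continuous s ∧ ∀ w, s (r w) = p i w := by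
  classical
  induction F using Finset.induction_on with
  | empty =>
    exact ⟨L.extFlow, fun w => L.toExtFlow (y w) (hye w), L.extIncl, continuous_extIncl,
      continuous_extFlow_iff.2 hy, fun g w => extIncl_injective (hyg g w), fun _ => rfl,
      isProxIrrExtension_barycenter_extFlow L, by simp⟩
  | insert a F ha ih =>
    obtain ⟨V, r, ρ, hρ, hr, hrg, hρr, hPI, hs⟩ := ih
    -- Adjoin one coordinate: `V'` is the image of `W` in `V × (K a).extFlow` and inherits
    -- minimality. The main lemma makes `P(V') → P(V)` proximally irreducible, and `hL` composes it
    -- with `P(V) → L`.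
    obtain ⟨V', r', j, hr', hj, hrg', hjg, hrs, hji, hjr⟩ := GFlow.exists_image
      (V := V.prod (K a).extFlow) (m := fun w => (r w, p a w)) (hr.prodMk (hp a))
      (fun g w => Prod.ext (hrg g w) (hpg a g w))
    have hc1 : Continuous fun v => (j v).1 := continuous_fst.comp hj
    have hc2 : Continuous fun v => (j v).2 := continuous_snd.comp hj
    have hg1 : ∀ (g : G) (v : V'), (j (g • v)).1 = g • (j v).1 := fun g v => by rw [hjg]; rfl
    have hg2 : ∀ (g : G) (v : V'), (j (g • v)).2 = g • (j v).2 := fun g v => by rw [hjg]; rfl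
    have hd : Continuous fun v => diracProb V (j v).1 := continuous_diracProb.comp hc1
    have hbr : ∀ w, barycenter hρ (diracProb V (j (r' w)).1) = y w := fun w => by
      rw [barycenter_dirac, hjr, hρr]
    have hα := isProxIrrExtension_barycenter_of_minimal hPI (hφ a) (W := V') (q := fun v =>
        (K a).extIncl (j v).2) hd (continuous_extIncl.comp hc2)
      (fun g v => by rw [hg1, diracProb_smul]) (fun g v => by rw [hg2, extIncl_smul])
      (fun v => mem_extClosure_probFlow.2 ⟨_, rfl⟩) (fun v => extIncl_mem _)
      (fun v => by
        obtain ⟨w, rfl⟩ := hrs v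
        rw [hbr, hjr, hpy])
      (fun v v' h1 h2 => hji (Prod.ext (diracProb_injective h1) (extIncl_injective h2)))
      (fun z hz => by
        obtain ⟨w, rfl⟩ := hsurj z hz
        exact ⟨r' w, hbr w⟩)
      (fun T hT hTg h => by
        have := hmin (r' ⁻¹' T) (hT.preimage hr') (fun g w hw => by
          rw [mem_preimage, hrg']
          exact hTg g _ hw) fun z hz => by
            obtain ⟨v, hv, rfl⟩ := h z hz
            obtain ⟨w, rfl⟩ := hrs v
            exact ⟨w, hv, (hbr w).symm⟩
        refine eq_univ_of_forall fun v => ?_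
        obtain ⟨w, rfl⟩ := hrs v
        exact (this ▸ mem_univ w : w ∈ r' ⁻¹' T))
    have hcomp := hL _ _ _ _ hPI hα
    have hρ' : Continuous fun v => ρ (j v).1 := hρ.comp hc1
    have heq : barycenter hρ' = barycenter hρ ∘ barycenter hd :=
      probFlow_map_ext (continuous_barycenter _) hcomp.continuous
        (preservesConvexComb_barycenter _) hcomp.affine fun v => by
          simp only [Function.comp_apply, barycenter_dirac]
    refine ⟨V', r', fun v => ρ (j v).1, hρ', hr', hrg', fun w => by simp only [hjr, hρr], heq ▸ hcomp,
      fun i hi => ?_⟩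
    rcases Finset.mem_insert.1 hi with rfl | hi
    · exact ⟨fun v => (j v).2, hc2, fun w => by simp only [hjr]⟩
    · obtain ⟨s, hsc, hsr⟩ := hs i hi
      exact ⟨fun v => s (j v).1, hsc.comp hc1, fun w => by simp only [hjr, hsr]⟩

/-- A minimal flow over `L` that embeds into a fiber product of proximally irreducible extensions
of `L` gives a proximally irreducible extension. -/
theorem isProxIrrExtension_barycenter_of_separating [Nonempty I] (hL : L.ComposesProxIrr)
    (hφ : ∀ i, IsProxIrrExtension (φ i))
    (hp : ∀ i, Continuous (p i)) (hpg : ∀ i (g : G) (w : W), p i (g • w) = g • p i w)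
    (hy : Continuous y) (hyg : ∀ (g : G) (w : W), y (g • w) = g • y w)
    (hye : ∀ w, (y w : L.E) ∈ L.extClosure) (hpy : ∀ i w, φ i ((K i).extIncl (p i w)) = y w)
    (hsurj : ∀ z : L, (z : L.E) ∈ L.extClosure → ∃ w, y w = z)
    (hmin : ∀ T : Set W, IsClosed T → (∀ (g : G) (w : W), w ∈ T → g • w ∈ T) →
      (∀ z : L, (z : L.E) ∈ L.extClosure → ∃ w ∈ T, y w = z) → T = univ)
    (hsep : ∀ w w', (∀ i, p i w = p i w') → w = w') :
    IsProxIrrExtension (barycenter hy) := by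
  refine ⟨isAffineExtension_barycenter hy hyg fun z hz => hsurj z (subset_closure hz), ?_⟩
  intro C hC h
  refine hC.eq_carrier_of_diracProb_mem fun w₀ => ?_
  have hCc := hC.isClosed_preimage
  have hd : ∀ i, Continuous fun w => diracProb (K i).extFlow (p i w) := fun i =>
    continuous_diracProb.comp (hp i)
  -- `B i` is the face of measures with `i`-th image the Dirac measure at `p i w₀`. Finitely many of
  -- these meet `C` together by the finite case, so all do by compactness; since the `p i` separate
  -- points, their intersection is the Dirac measure at `w₀`.
  let B : I → Set (probFlow W) := fun i => barycenter (hd i) ⁻¹' {diracProb _ (p i w₀)}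
  have hB : ∀ i, IsClosed (B i) := fun i =>
    isClosed_singleton.preimage (continuous_barycenter (hd i))
  have hmem : ∀ i w, diracProb W w ∈ B i ↔ p i w = p i w₀ := fun i w => by
    rw [mem_preimage, barycenter_dirac, mem_singleton_iff]
    exact diracProb_injective.eq_iff
  obtain ⟨Λ, hΛC, hΛ⟩ := hCc.isCompact.inter_iInter_nonempty B hB fun F => by
    obtain ⟨V, r, ρ, hρ, hr, hrg, hρr, hPI, hs⟩ :=
      exists_proxIrr_factor hL hφ hp hpg hy hyg hye hpy hsurj hmin F
    have hA : Continuous fun w => diracProb V (r w) := continuous_diracProb.comp hr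
    have hAg : ∀ (g : G) (w : W), diracProb V (r (g • w)) = g • diracProb V (r w) := fun g w => by
      rw [hrg, diracProb_smul]
    have hmeet : diracProb V (r w₀) ∈ barycenter hA '' {Λ | (Λ : (probFlow W).E) ∈ C} := by
      refine hPI.mem_of_meets (hCc.isCompact.image (continuous_barycenter hA)).isClosed ?_
        (fun z hz => ?_) (mem_extClosure_probFlow.2 ⟨_, rfl⟩)
      · rintro g _ ⟨Λ, hΛ, rfl⟩
        exact ⟨g • Λ, hC.smul_mem g Λ hΛ, barycenter_smul hA hAg g Λ⟩
      · obtain ⟨Λ₀, hΛC, hΛ⟩ := h z hz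
        lift Λ₀ to probFlow W using hC.subset hΛC with Λ
        refine ⟨_, ⟨Λ, hΛC, rfl⟩, convexHull_mono ?_
          ((preservesConvexComb_barycenter hA).map_mem_convexHull (probFlow W).convex hΛ)⟩
        rintro _ ⟨_, ⟨Θ, ⟨hΘ, hΘz⟩, rfl⟩, rfl⟩
        obtain ⟨w, rfl⟩ := mem_extClosure_probFlow.1 hΘ
        rw [barycenter_dirac] at hΘz
        rw [barycenter_dirac]
        exact ⟨_, ⟨mem_extClosure_probFlow.2 ⟨_, rfl⟩, by rw [barycenter_dirac, hρr, hΘz]⟩, rfl⟩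
    obtain ⟨Λ, hΛC, hΛ⟩ := hmeet
    refine ⟨Λ, hΛC, mem_iInter₂.2 fun i hi => ?_⟩
    obtain ⟨s, hsc, hsr⟩ := hs i hi
    have hds : Continuous fun v => diracProb (K i).extFlow (s v) := continuous_diracProb.comp hsc
    have hfac : barycenter (hd i) = barycenter hds ∘ barycenter hA :=
      probFlow_map_ext (continuous_barycenter _)
        ((continuous_barycenter hds).comp (continuous_barycenter hA))
        (preservesConvexComb_barycenter _)
        (fun x y z a b ha hb hab h => preservesConvexComb_barycenter hds _ _ _ a b ha hb hab
          (preservesConvexComb_barycenter hA x y z a b ha hb hab h)) fun w => by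
          simp only [Function.comp_apply, barycenter_dirac, hsr]
    rw [mem_preimage, hfac, Function.comp_apply, hΛ, barycenter_dirac, hsr]
    rfl
  have himg : (Subtype.val '' ⋂ i, B i : Set (probFlow W).E) = ⋂ i, Subtype.val '' B i :=
    Subtype.val_injective.injOn.image_iInter_eq
  obtain ⟨w, rfl⟩ := exists_diracProb_mem_face (isClosed_iInter hB)
    (himg ▸ isExtreme_iInter fun i => (preservesConvexComb_barycenter (hd i)).isExtreme_preimage
      (diracProb_mem_extremePoints _))
    (himg ▸ convex_iInter fun i =>
      (preservesConvexComb_barycenter (hd i)).convex_fiber (probFlow W).convex _) hΛ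
    fun w w' hw hw' => hsep w w' fun i =>
      ((hmem i w).1 (mem_iInter.1 hw i)).trans ((hmem i w').1 (mem_iInter.1 hw' i)).symm
  rwa [← hsep w w₀ fun i => (hmem i w).1 (mem_iInter.1 hΛ i)]

end InverseLimit

theorem exists_isMaxProxIrrExtension {L : AffineFlow G} (hL : L.ComposesProxIrr) :
    ∃ (X : GFlow G) (φ : probFlow X → L), IsMaxProxIrrExtension φ := by
  obtain ⟨I, K, φ, hφ, hdom⟩ := exists_dominating_family L
  have hI : Nonempty I := ⟨(hdom _ _ (isProxIrrExtension_barycenter_extFlow L)).choose⟩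
  let i₀ : I := Classical.arbitrary I
  let V : GFlow G := GFlow.pi fun i => (K i).extFlow
  let p₀ : ∀ i, V → L := fun i v => φ i ((K i).extIncl (v i))
  have hp₀ : ∀ i, Continuous (p₀ i) := fun i =>
    (hφ i).continuous.comp (continuous_extIncl.comp (continuous_apply i))
  have hp₀g : ∀ i (g : G) (v : V), p₀ i (g • v) = g • p₀ i v := fun i g v =>
    (hφ i).map_smul g ((K i).extIncl (v i))
  obtain ⟨W, j, hj, hjg, hji, hR, hsurj, hmin⟩ := GFlow.exists_minimal (V := V) (hp₀ i₀)
    (S := {z : L | (z : L.E) ∈ L.extClosure}) (R := ⋂ i, {v | p₀ i v = p₀ i₀ v})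
    (isClosed_iInter fun i => isClosed_eq (hp₀ i) (hp₀ i₀))
    (fun g v hv => mem_iInter.2 fun i => by
      change p₀ i (g • v) = p₀ i₀ (g • v)
      rw [hp₀g, hp₀g, show p₀ i v = p₀ i₀ v from mem_iInter.1 hv i])
    (fun z hz => by
      choose x hx hxz using fun i => (hφ i).exists_mem_extClosure hz
      exact ⟨fun i => (K i).toExtFlow (x i) (hx i),
        mem_iInter.2 fun i => (hxz i).trans (hxz i₀).symm, hxz i₀⟩)
  have hy : Continuous fun w => p₀ i₀ (j w) := (hp₀ i₀).comp hj
  have hyg : ∀ (g : G) (w : W), p₀ i₀ (j (g • w)) = g • p₀ i₀ (j w) := fun g w => by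
    rw [hjg, hp₀g]
  have hPI := isProxIrrExtension_barycenter_of_separating (p := fun i w => j w i) hL hφ
    (fun i => (continuous_apply i).comp hj) (fun i g w => by rw [hjg]; rfl) hy hyg
    (fun w => (hφ i₀).map_mem_extClosure (extIncl_mem _)) (fun i w => mem_iInter.1 (hR w) i)
    hsurj hmin (fun w w' h => hji (funext h))
  refine ⟨W, barycenter hy, hPI, fun Q ψ hψ => ⟨hψ.toIsAffineExtension, ?_⟩⟩
  -- The composite `Q → L` is again proximally irreducible, so some factor of the product dominates
  -- it, and the corresponding coordinate of `W` gives `b : W → Q` over `L`.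
  have hθ := hL _ _ _ _ hPI hψ
  obtain ⟨i, a, ha, hag, hθa⟩ := hdom Q _ hθ
  let b : W → Q := fun w => Q.extIncl (a (j w i))
  have hb : Continuous b :=
    continuous_extIncl.comp (ha.comp ((continuous_apply i).comp hj))
  have hbg : ∀ (g : G) (w : W), b (g • w) = g • b w := fun g w => by
    change Q.extIncl (a (j (g • w) i)) = g • Q.extIncl (a (j w i))
    rw [hjg, ← extIncl_smul, ← hag]
    rfl
  have hby : ∀ w, barycenter hy (ψ (b w)) = p₀ i₀ (j w) := fun w =>
    (hθa (j w i)).trans (mem_iInter.1 (hR w) i)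
  -- By rigidity `ψ ∘ b` is the Dirac embedding. The barycenter map of `b` is then a section of `ψ`;
  -- it is also onto `Q`, so `ψ` is injective.
  have hid : diracProb W = fun w => ψ (b w) := by
    refine hPI.eq_of_minimal continuous_diracProb (hψ.continuous.comp hb) diracProb_smul
      (fun g w => by rw [hbg, hψ.map_smul]) (fun w => mem_extClosure_probFlow.2 ⟨w, rfl⟩)
      (fun w => hψ.map_mem_extClosure (extIncl_mem _))
      (fun w => by rw [barycenter_dirac, hby]) (fun z hz => ?_) (fun T hT hTg h => ?_)
    · obtain ⟨w, hw⟩ := hsurj z hz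
      exact ⟨w, by rw [barycenter_dirac, hw]⟩
    · refine hmin T hT hTg fun z hz => ?_
      obtain ⟨w, hw, hwz⟩ := h z hz
      exact ⟨w, hw, by rw [← hwz, barycenter_dirac]⟩
  have hA := isAffineExtension_barycenter hb hbg fun x hx =>
    hθ.mem_of_surjOn (isCompact_range hb).isClosed
      (by rintro g _ ⟨w, rfl⟩; exact ⟨g • w, hbg g w⟩) (fun z hz => by
        obtain ⟨w, hw⟩ := hsurj z hz
        exact ⟨b w, ⟨w, rfl⟩, extIncl_mem _, (hby w).trans hw⟩) (subset_closure hx)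
  have hψA : ψ ∘ barycenter hb = id :=
    probFlow_map_ext (hψ.continuous.comp hA.continuous) continuous_id
      (hψ.toIsAffineExtension.comp hA).affine (fun _ _ _ _ _ _ _ _ h => h) fun w => by
        rw [Function.comp_apply, barycenter_dirac]
        exact (congrFun hid w).symm
  intro u v huv
  obtain ⟨u, rfl⟩ := hA.surjective u
  obtain ⟨v, rfl⟩ := hA.surjective v
  have hu : ψ (barycenter hb u) = u := congrFun hψA u
  have hv : ψ (barycenter hb v) = v := congrFun hψA v
  rw [hu, hv] at huv
  rw [huv]

end AffineFlow

theorem mainTheorem9 {G : Type u} [Group G] [TopologicalSpace G] [IsTopologicalGroup G]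
    [PolishSpace G] :
    -- existence of a maximal proximally irreducible extension, of the form `P(X)`
    (∀ L : AffineFlow G, L.ComposesProxIrr →
      ∃ (X : GFlow G) (φ : probFlow X → L), AffineFlow.IsMaxProxIrrExtension φ) ∧
    -- uniqueness, up to an isomorphism over `L`
    (∀ (L K K' : AffineFlow G) (φ : K → L) (ψ : K' → L),
      AffineFlow.IsMaxProxIrrExtension φ → AffineFlow.IsMaxProxIrrExtension ψ →
      ∃ η : K → K', AffineFlow.IsAffineIso η ∧ ψ ∘ η = φ) ∧
    -- uniqueness of the flow `X`, up to isomorphism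
    (∀ (L : AffineFlow G) (X Z : GFlow G) (φ : probFlow X → L) (ψ : probFlow Z → L),
      AffineFlow.IsMaxProxIrrExtension φ → AffineFlow.IsMaxProxIrrExtension ψ →
      ∃ e : X ≃ₜ Z, ∀ (g : G) (x : X), e (g • x) = g • e x) ∧
    -- the hypothesis holds for `P(Y)` when `Y` is minimal or has a comeager orbit
    (∀ Y : GFlow G,
      MulAction.IsMinimal G Y ∨ (∃ y : Y, MulAction.orbit G y ∈ residual Y) →
      (probFlow Y).ComposesProxIrr) := by
  refine ⟨fun L hL => AffineFlow.exists_isMaxProxIrrExtension hL,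
    fun L K K' φ ψ hφ hψ => hφ.exists_iso hψ, fun L X Z φ ψ hφ hψ => ?_, fun Y hY => ?_⟩
  · obtain ⟨η, hη, -⟩ := hφ.exists_iso hψ
    exact AffineFlow.exists_homeomorph_of_isAffineIso hη
  · rcases hY with hY | ⟨y, hy⟩
    -- `MulAction.IsMinimal` allows the empty flow, which has no orbit to use.
    · rcases isEmpty_or_nonempty Y with h | ⟨⟨y⟩⟩
      · exact AffineFlow.composesProxIrr_probFlow_of_isEmpty h
      · exact AffineFlow.composesProxIrr_probFlow (MulAction.dense_orbit G y)
    · exact AffineFlow.composesProxIrr_probFlow (dense_of_mem_residual hy)
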